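/- Let $d\ge 3$ be an integer and $q=2^d$, and let $G$ be the group $\mathrm{PSL}(2,q)$ as a transitive permutation group of degree $q(q-1)/2$ on a finite set $\Omega$. Let $\mathcal X=\mathrm{Inv}(G)$ be the large Hollmann scheme, i.e. the coherent configuration on $\Omega$ whose basis relations are the orbits of $G$ on $\Omega\times\Omega$, and let $\mathbf T_0=\{x\in\mathbb F_q:\mathrm{Tr}(x)=0\}$, where $\mathrm{Tr}$ is the trace of $\mathbb F_q$ over $\mathbb F_2$. For a relation $r\subseteq\Omega\times\Omega$ and $\alpha\in\Omega$ put $r^*=\{(\beta,\gamma):(\gamma,\beta)\in r\}$ and $\alpha r=\{\beta:(\alpha,\beta)\in r\}$. There is a bijection $x\mapsto s_x$ from $\mathbf T_0$ onto the set of basis relations of $\mathcal X$ such that $s_0=1_\Omega$ is the diagonal and, for all $x,y,z\in\mathbf T_0$ with $z\neq 0$, the intersection number $c_{s_x,s_y}^{s_z}=|\beta s_x\cap\gamma s_y^*|$, $(\beta,\gamma)\in s_z$, equals $1$ if and only if $\mathrm{Tr}(xz)=0$ and $x+y+z=0$. Moreover, let $x\mapsto s_x$ be any such bijection, let $\alpha\in\Omega$,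 and let $\mathcal X_\alpha$ be the one-point extension of $\mathcal X$, i.e. the smallest coherent configuration on $\Omega$ for which all basis relations of $\mathcal X$ and $\{(\alpha,\alpha)\}$ are relations (unions of basis relations). Then for all nonzero $x,y\in\mathbf T_0$ the sets $\Delta_x=\alpha s_x$ and $\Delta_y=\alpha s_y$ are fibers of $\mathcal X_\alpha$, and among the basis relations of $\mathcal X_\alpha$ contained in $\Delta_x\times\Delta_y$ there is a matching, i.e. a basis relation $r$ with $|\delta r|=1$ for all $\delta\in\Delta_x$ and $|\gamma r^*|=1$ for all $\gamma\in\Delta_y$. -/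

import Mathlib

namespace Hollmann

/-! ### Relations -/

section Relations

variable {Ω : Type*}

/-- The transposed relation `r*`. -/
def relStar (r : Set (Ω × Ω)) : Set (Ω × Ω) := {p | (p.2, p.1) ∈ r}

/-- The neighbourhood `α r = {β | (α, β) ∈ r}`. -/
def nbr (α : Ω) (r : Set (Ω × Ω)) : Set Ω := {β | (α, β) ∈ r}

/-- The diagonal `1_Δ` of `Δ × Δ`, as a relation on `Ω`. -/
def diagOn (Δ : Set Ω) : Set (Ω × Ω) := {p | p.1 = p.2 ∧ p.1 ∈ Δ}

/-- The set `S^∪` of all unions of members of `S`. -/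
def unions (S : Set (Set (Ω × Ω))) : Set (Set (Ω × Ω)) := {r | ∃ T ⊆ S, r = ⋃₀ T}

/-- The number `|α r ∩ β s*|`. -/
noncomputable def pathCount (r s : Set (Ω × Ω)) (α β : Ω) : ℕ :=
  (nbr α r ∩ nbr β (relStar s)).ncard

end Relations

/-! ### Rainbows and coherent configurations -/

/-- A rainbow: a partition `S` of `Ω × Ω` with `1_Ω ∈ S^∪` and `S* = S`. -/
structure Rainbow (Ω : Type*) where
  basis : Set (Set (Ω × Ω))
  isPartition : Setoid.IsPartition basis
  diag_mem : diagOn (Set.univ : Set Ω) ∈ unions basis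
  star_eq : relStar '' basis = basis

/-- A coherent configuration: a rainbow with well-defined intersection numbers. -/
structure CoherentConfiguration (Ω : Type*) extends Rainbow Ω where
  coherent : ∀ r ∈ basis, ∀ s ∈ basis, ∀ t ∈ basis, ∀ α β α' β' : Ω,
    (α, β) ∈ t → (α', β') ∈ t → pathCount r s α β = pathCount r s α' β'

namespace CoherentConfiguration

variable {Ω : Type*}

/-- The relations of `X`, i.e. the unions of basis relations. -/
def relations (X : CoherentConfiguration Ω) : Set (Set (Ω × Ω)) := unions X.basis

/-- `X ≤ Y` iff every relation of `X` is a relation of `Y`. -/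
instance : LE (CoherentConfiguration Ω) := ⟨fun X Y => X.relations ⊆ Y.relations⟩

/-- The fibers: the sets `Δ` for which `1_Δ` is a basis relation. -/
def fibers (X : CoherentConfiguration Ω) : Set (Set Ω) := {Δ | diagOn Δ ∈ X.basis}

/-- `S_{Δ,Γ}`: the basis relations contained in `Δ × Γ`. -/
def basisBetween (X : CoherentConfiguration Ω) (Δ Γ : Set Ω) : Set (Set (Ω × Ω)) :=
  {s | s ∈ X.basis ∧ s ⊆ Δ ×ˢ Γ}

/-- `n_s = n`: the relation `s` lies in `S_{Δ,Γ}` for some fibers `Δ`, `Γ`,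
and `|δ s| = n` for all `δ ∈ Δ`. -/
def HasValency (X : CoherentConfiguration Ω) (s : Set (Ω × Ω)) (n : ℕ) : Prop :=
  ∃ Δ ∈ X.fibers, ∃ Γ ∈ X.fibers, s ∈ X.basisBetween Δ Γ ∧ ∀ δ ∈ Δ, (nbr δ s).ncard = n

/-- A matching: a basis relation `s` with `n_s = n_{s*} = 1`. -/
def IsMatching (X : CoherentConfiguration Ω) (s : Set (Ω × Ω)) : Prop :=
  s ∈ X.basis ∧ X.HasValency s 1 ∧ X.HasValency (relStar s) 1

end CoherentConfiguration

/-! ### Coherent closure and point extensions -/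

section Closure

variable {Ω : Type*}

theorem relStar_relStar (r : Set (Ω × Ω)) : relStar (relStar r) = r := rfl

/-- A set of pairs is a union of cells of a partition iff it contains, with each point,
the whole cell of this point. -/
theorem mem_unions_iff {S : Set (Set (Ω × Ω))} (hS : Setoid.IsPartition S)
    {r : Set (Ω × Ω)} :
    r ∈ unions S ↔ ∀ t ∈ S, ∀ p ∈ t, ∀ q ∈ t, p ∈ r → q ∈ r := by
  constructor
  · rintro ⟨T, hT, rfl⟩ t ht p hp q hq ⟨u, hu, hpu⟩
    have : t = u := (hS.2 p).unique ⟨ht, hp⟩ ⟨hT hu, hpu⟩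
    exact ⟨u, hu, this ▸ hq⟩
  · intro h
    refine ⟨{t | t ∈ S ∧ t ⊆ r}, fun t ht => ht.1, ?_⟩
    ext p
    constructor
    · intro hp
      obtain ⟨t, ⟨ht, hpt⟩, -⟩ := hS.2 p
      exact ⟨t, ⟨ht, fun q hq => h t ht p hpt q hq hp⟩, hpt⟩
    · rintro ⟨t, ht, hpt⟩
      exact ht.2 hpt

/-- The relations common to all coherent configurations having all members of `T` as
relations. -/
def commonRelations (T : Set (Set (Ω × Ω))) : Set (Set (Ω × Ω)) :=
  {r | ∀ Y : CoherentConfiguration Ω, T ⊆ Y.relations → r ∈ Y.relations}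

/-- Two pairs are equivalent if no common relation separates them. -/
def closureSetoid (T : Set (Set (Ω × Ω))) : Setoid (Ω × Ω) where
  r p q := ∀ r ∈ commonRelations T, p ∈ r ↔ q ∈ r
  iseqv := ⟨fun _ _ _ => Iff.rfl, fun h r hr => (h r hr).symm,
    fun h h' r hr => (h r hr).trans (h' r hr)⟩

theorem class_mem_common {T : Set (Set (Ω × Ω))} {c : Set (Ω × Ω)}
    (hc : c ∈ (closureSetoid T).classes) : c ∈ commonRelations T := by
  obtain ⟨p, rfl⟩ := hc
  intro Y hY
  refine (mem_unions_iff Y.isPartition).2 fun t ht a ha b hb hap => ?_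
  intro r hr
  have h := (mem_unions_iff Y.isPartition).1 (hr Y hY)
  exact ⟨fun hbr => (hap r hr).1 (h t ht b hb a ha hbr),
    fun hpr => h t ht a ha b hb ((hap r hr).2 hpr)⟩

theorem relStar_mem_common {T : Set (Set (Ω × Ω))} {r : Set (Ω × Ω)}
    (hr : r ∈ commonRelations T) : relStar r ∈ commonRelations T := by
  intro Y hY
  have h := (mem_unions_iff Y.isPartition).1 (hr Y hY)
  refine (mem_unions_iff Y.isPartition).2 fun t ht a ha b hb har => ?_
  have ht' : relStar t ∈ Y.basis := by
    rw [← Y.star_eq]; exact ⟨t, ht, rfl⟩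
  exact h (relStar t) ht' (a.2, a.1) ha (b.2, b.1) hb har

theorem mem_unions_closure_iff {T : Set (Set (Ω × Ω))} {r : Set (Ω × Ω)} :
    r ∈ unions (closureSetoid T).classes ↔ r ∈ commonRelations T := by
  constructor
  · rintro ⟨U, hU, rfl⟩ Y hY
    refine (mem_unions_iff Y.isPartition).2 ?_
    rintro t ht a ha b hb ⟨u, hu, hau⟩
    exact ⟨u, hu, (mem_unions_iff Y.isPartition).1 (class_mem_common (hU hu) Y hY)
      t ht a ha b hb hau⟩
  · intro hr
    refine (mem_unions_iff (Setoid.isPartition_classes _)).2 ?_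
    rintro _ ⟨c, rfl⟩ a ha b hb har
    exact (hb r hr).2 ((ha r hr).1 har)

theorem pathCount_congr (Y : CoherentConfiguration Ω) [Finite Ω] {r s t : Set (Ω × Ω)}
    (hr : r ∈ Y.relations) (hs : s ∈ Y.relations) (ht : t ∈ Y.basis)
    {α β α' β' : Ω} (h : (α, β) ∈ t) (h' : (α', β') ∈ t) :
    pathCount r s α β = pathCount r s α' β' := by
  classical
  obtain ⟨R, hR, rfl⟩ := hr
  obtain ⟨U, hU, rfl⟩ := hs
  have key : ∀ a b : Ω, pathCount (⋃₀ R) (⋃₀ U) a b =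
      ∑ᶠ x : R × U, pathCount x.1.1 x.2.1 a b := by
    intro a b
    have hset : nbr a (⋃₀ R) ∩ nbr b (relStar (⋃₀ U)) =
        ⋃ x : R × U, (nbr a x.1.1 ∩ nbr b (relStar x.2.1)) := by
      ext c
      simp only [nbr, relStar, Set.mem_inter_iff, Set.mem_ofPred_eq, Set.mem_sUnion,
        Set.mem_iUnion]
      constructor
      · rintro ⟨⟨x, hx, hx'⟩, ⟨y, hy, hy'⟩⟩
        exact ⟨(⟨x, hx⟩, ⟨y, hy⟩), hx', hy'⟩
      · rintro ⟨⟨⟨x, hx⟩, ⟨y, hy⟩⟩, hx', hy'⟩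
        exact ⟨⟨x, hx, hx'⟩, ⟨y, hy, hy'⟩⟩
    unfold pathCount
    rw [hset]
    have hfin : Finite (R × U) := inferInstance
    have := Fintype.ofFinite (R × U)
    rw [finsum_eq_sum_of_fintype]
    have := Set.ncard_iUnion_of_finite
      (s := fun x : R × U => nbr a x.1.1 ∩ nbr b (relStar x.2.1))
      (fun x => Set.toFinite _) (by
        rintro ⟨⟨x, hx⟩, ⟨y, hy⟩⟩ ⟨⟨x', hx'⟩, ⟨y', hy'⟩⟩ hne
        refine Set.disjoint_left.2 ?_
        rintro c ⟨h1, h2⟩ ⟨h3, h4⟩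
        apply hne
        have e1 : x = x' := (Y.isPartition.2 (a, c)).unique ⟨hR hx, h1⟩ ⟨hR hx', h3⟩
        have e2 : y = y' := (Y.isPartition.2 (c, b)).unique ⟨hU hy, h2⟩ ⟨hU hy', h4⟩
        subst e1 e2
        rfl)
    rw [this, finsum_eq_sum_of_fintype]
  rw [key, key]
  exact finsum_congr fun x =>
    Y.coherent _ (hR x.1.2) _ (hU x.2.2) t ht _ _ _ _ h h'

/-- The coherent closure `WL(T)`: the smallest coherent configuration on `Ω` for which all
members of `T` are relations (see `coherentClosure_isLeast`). -/
def coherentClosure [Finite Ω] (T : Set (Set (Ω × Ω))) : CoherentConfiguration Ω where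
  basis := (closureSetoid T).classes
  isPartition := Setoid.isPartition_classes _
  diag_mem := mem_unions_closure_iff.2 fun Y _ => Y.diag_mem
  star_eq := by
    have h : ∀ c ∈ (closureSetoid T).classes, relStar c ∈ (closureSetoid T).classes := by
      rintro _ ⟨p, rfl⟩
      refine ⟨(p.2, p.1), ?_⟩
      ext a
      constructor
      · intro ha r hr
        exact ha (relStar r) (relStar_mem_common hr)
      · intro ha r hr
        exact ha (relStar r) (relStar_mem_common hr)
    ext c
    constructor
    · rintro ⟨e, he, rfl⟩
      exact h e he
    · intro hc
      exact ⟨relStar c, h c hc, rfl⟩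
  coherent := by
    intro r hr s hs t ht α β α' β' h h'
    have hmem : {p : Ω × Ω | pathCount r s p.1 p.2 = pathCount r s α β} ∈
        commonRelations T := by
      intro Y hY
      refine (mem_unions_iff Y.isPartition).2 fun u hu a ha b hb hab => ?_
      exact (pathCount_congr Y (class_mem_common hr Y hY) (class_mem_common hs Y hY)
        hu hb ha).trans hab
    obtain ⟨p, rfl⟩ := ht
    have : (α', β') ∈ {p : Ω × Ω | pathCount r s p.1 p.2 = pathCount r s α β} :=
      (h' _ hmem).2 ((h _ hmem).1 rfl)
    exact this.symm

theorem coherentClosure_isLeast [Finite Ω] (T : Set (Set (Ω × Ω))) :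
    IsLeast {Y : CoherentConfiguration Ω | T ⊆ Y.relations} (coherentClosure T) :=
  ⟨fun _ ht => mem_unions_closure_iff.2 fun _ hY => hY ht,
    fun Y hY _ hr => mem_unions_closure_iff.1 hr Y hY⟩

/-- The one-point extension `X_α = WL(S(X) ∪ {1_α})`. -/
def CoherentConfiguration.pointExtension [Finite Ω] (X : CoherentConfiguration Ω) (α : Ω) :
    CoherentConfiguration Ω :=
  coherentClosure (X.basis ∪ {diagOn {α}})

end Closure

/-! ### The coherent configuration of a permutation group -/

section Inv

variable {Ω : Type*}

/-- The coherent configuration `Inv(G)` of a permutation group `G` on `Ω`: its basis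
relations are the orbits of `G` on `Ω × Ω`. -/
def inv (G : Subgroup (Equiv.Perm Ω)) : CoherentConfiguration Ω where
  basis := Set.range fun p : Ω × Ω => MulAction.orbit G p
  isPartition := by
    refine ⟨?_, fun a => ⟨MulAction.orbit G a, ⟨⟨a, rfl⟩, MulAction.mem_orbit_self a⟩, ?_⟩⟩
    · rintro ⟨p, hp⟩
      exact (MulAction.nonempty_orbit p).ne_empty hp
    · rintro _ ⟨⟨p, rfl⟩, hp⟩
      exact (MulAction.orbit_eq_iff.2 hp).symm
  diag_mem := by
    refine ⟨{t | ∃ α : Ω, t = MulAction.orbit G (α, α)}, ?_, ?_⟩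
    · rintro _ ⟨α, rfl⟩
      exact ⟨_, rfl⟩
    · ext ⟨a, b⟩
      constructor
      · rintro ⟨h, -⟩
        simp only at h
        subst h
        exact ⟨_, ⟨a, rfl⟩, MulAction.mem_orbit_self _⟩
      · rintro ⟨_, ⟨α, rfl⟩, g, hg⟩
        have h1 : g • α = a := congrArg Prod.fst hg
        have h2 : g • α = b := congrArg Prod.snd hg
        exact ⟨h1.symm.trans h2, Set.mem_univ _⟩
  star_eq := by
    have h : ∀ p : Ω × Ω, relStar (MulAction.orbit G p) = MulAction.orbit G (p.2, p.1) := by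
      rintro ⟨a, b⟩
      ext ⟨c, e⟩
      constructor
      · rintro ⟨g, hg⟩
        exact ⟨g, Prod.ext (congrArg Prod.snd hg) (congrArg Prod.fst hg)⟩
      · rintro ⟨g, hg⟩
        exact ⟨g, Prod.ext (congrArg Prod.snd hg) (congrArg Prod.fst hg)⟩
    ext c
    constructor
    · rintro ⟨_, ⟨p, rfl⟩, rfl⟩
      exact ⟨_, (h p).symm⟩
    · rintro ⟨p, rfl⟩
      exact ⟨_, ⟨(p.2, p.1), rfl⟩, h _⟩
  coherent := by
    have hinv : ∀ (p : Ω × Ω) (g : G) (a b : Ω),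
        (g • a, g • b) ∈ MulAction.orbit G p ↔ (a, b) ∈ MulAction.orbit G p := by
      intro p g a b
      constructor
      · intro h
        have h' := MulAction.mem_orbit_of_mem_orbit g⁻¹ h
        rwa [Prod.smul_mk, inv_smul_smul, inv_smul_smul] at h'
      · intro h
        exact MulAction.mem_orbit_of_mem_orbit g h
    rintro _ ⟨r, rfl⟩ _ ⟨s, rfl⟩ _ ⟨t, rfl⟩ α β α' β' h h'
    have hm : (α', β') ∈ MulAction.orbit G (α, β) := by
      rw [MulAction.orbit_eq_iff.2 h]; exact h'
    obtain ⟨g, hg⟩ := hm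
    have h1 : g • α = α' := congrArg Prod.fst hg
    have h2 : g • β = β' := congrArg Prod.snd hg
    subst h1 h2
    refine Set.ncard_congr (fun c _ => g • c) ?_ ?_ ?_
    · rintro c ⟨hc, hc'⟩
      exact ⟨(hinv r g α c).2 hc, (hinv s g c β).2 hc'⟩
    · intro a b _ _ hab
      exact MulAction.injective g hab
    · rintro c ⟨hc, hc'⟩
      refine ⟨g⁻¹ • c, ⟨?_, ?_⟩, smul_inv_smul g c⟩
      · refine (hinv r g α (g⁻¹ • c)).1 ?_
        rw [smul_inv_smul]; exact hc
      · refine (hinv s g (g⁻¹ • c) β).1 ?_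
        rw [smul_inv_smul]; exact hc'

end Inv

/-! ### Large Hollmann schemes -/

/-- `T₀`: the elements of trace zero over the prime field `𝔽₂`. -/
noncomputable def traceZero (F : Type*) [Field F] [Algebra (ZMod 2) F] :
    Submodule (ZMod 2) F :=
  LinearMap.ker (Algebra.trace (ZMod 2) F)

/-- `G` is the group `PSL(2, F)` as a transitive permutation group of degree `q(q-1)/2`,
where `q = |F|`. -/
structure IsHollmannGroup (F : Type*) [Field F] {Ω : Type*}
    (G : Subgroup (Equiv.Perm Ω)) : Prop where
  iso : Nonempty (G ≃* Matrix.ProjectiveSpecialLinearGroup (Fin 2) F)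
  transitive : MulAction.IsPretransitive G Ω
  degree : Nat.card Ω = Nat.card F * (Nat.card F - 1) / 2

/-- `x ↦ s_x` is a bijection from `T₀` onto the basis relations of `X` such that `s_0` is the
diagonal and, for all `x`, `y` and all `z ≠ 0`, the intersection number of `s_x`, `s_y` with
respect to `s_z` equals `1` iff `Tr(xz) = 0` and `x + y + z = 0`. -/
structure IsHollmannLabelling {F : Type*} [Field F] [Algebra (ZMod 2) F] {Ω : Type*}
    (X : CoherentConfiguration Ω) (s : traceZero F → Set (Ω × Ω)) : Prop where
  bijOn : Set.BijOn s Set.univ X.basis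
  zero : s 0 = Set.diagonal Ω
  intersection : ∀ x y z : traceZero F, z ≠ 0 → ∀ β γ : Ω, (β, γ) ∈ s z →
    (pathCount (s x) (s y) β γ = 1 ↔
      Algebra.trace (ZMod 2) F ((x : F) * (z : F)) = 0 ∧ x + y + z = 0)

end Hollmann

/-!
In characteristic two the quadratic forms `a X ^ 2 + X Y + b Y ^ 2` share one polar form `B`, and
they are an affine space over `F ^ 2` on which `v` translates by `B(v, ·) ^ 2`. The group `SL(2, F)`
acts transitively on the `q (q - 1) / 2` elliptic ones, and these model `Ω`: the stabilizer in
`SL(2, F)` of a point of `Ω` has order `2 (q + 1)`, hence a normal subgroup of odd order `q + 1`,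
which fixes exactly one form, and that form is elliptic.

The orbit of a pair `(Q, v + Q)` is determined by its label `Q v`, an element of trace zero; this
defines `s_x`. Relative to a base point with form `Q`, the points are the vectors `v` with
`Tr (Q v) = 0`, and the pair of `v` and `w` has label `Q v + Q w + B(v, w) + B(v, w) ^ 2`. So an
intersection number counts the `v` with `Q v = x` and `B(v, w) + B(v, w) ^ 2 = x + y + z`, where
`Q w = z`. The reflection in `w` permutes these `v`, so if there is only one, it is a multiple
of `w`.

The matching from `Δ_x` to `Δ_y` is `v ↦ k v` with `k ^ 2 = y / x`. The pairs `(v, w)` in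
`Δ_x × Δ_y` with label `x + y` are those with `B(v, w)` equal to `0` or `1`, that is, with
`w = k v` or `B(v, w) = 1`. A suitable path count is one exactly in the second case, again because
of a reflection, apart from a few exceptional `k`, which are reached by transposing and composing
matchings.
-/

namespace Hollmann

open scoped Matrix MatrixGroups

/-! ### The trace of a finite field of characteristic two -/

section Trace

variable {F : Type*} [Field F] [Algebra (ZMod 2) F]

instance charP_two : CharP F 2 :=
  charP_of_injective_algebraMap (algebraMap (ZMod 2) F).injective 2

variable [Finite F]

local notation "Tr" => Algebra.trace (ZMod 2) F

theorem trace_sq (a : F) : Tr (a ^ 2) = Tr a :=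
  Algebra.trace_eq_of_algEquiv (FiniteField.frobeniusAlgEquiv (ZMod 2) F 2) a

theorem trace_add_sq (a : F) : Tr (a + a ^ 2) = 0 := by
  rw [map_add, trace_sq, CharTwo.add_self_eq_zero]

theorem two_mul_card_traceZero : 2 * Nat.card (traceZero F) = Nat.card F := by
  have e := (Tr).quotKerEquivOfSurjective (Algebra.trace_surjective (ZMod 2) F)
  rw [(traceZero F).card_eq_card_quotient_mul_card, mul_comm, traceZero, Nat.card_congr e.toEquiv,
    Nat.card_zmod]

theorem add_sq_eq_zero_iff {R : Type*} [CommRing R] [IsDomain R] [CharP R 2] {a : R} :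
    a + a ^ 2 = 0 ↔ a = 0 ∨ a = 1 := by
  rw [← CharTwo.add_eq_zero (b := (1 : R)), ← mul_eq_zero, mul_add_one, sq, add_comm]

-- Additive Hilbert 90: the image of `a ↦ a + a ^ 2` lies in `T₀`, and since the kernel is
-- `{0, 1}` both have `|F| / 2` elements.
theorem exists_add_sq_eq {t : F} (ht : Tr t = 0) : ∃ a : F, a + a ^ 2 = t := by
  let f : F →+ F := AddMonoidHom.id F + (frobenius F 2 : F →+ F)
  have hker : Nat.card f.ker = 2 := by
    have : (f.ker : Set F) = {0, 1} := Set.ext fun a => add_sq_eq_zero_iff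
    rw [← SetLike.coe_sort_coe, this, Nat.card_coe_set_eq, Set.ncard_pair zero_ne_one]
  have hle : f.range ≤ (traceZero F).toAddSubgroup := by
    rintro _ ⟨a, rfl⟩
    exact trace_add_sq a
  have hcard : Nat.card (traceZero F).toAddSubgroup ≤ Nat.card f.range := by
    have h1 : 2 * Nat.card f.range = Nat.card F := by
      rw [← hker, ← AddSubgroup.index_ker, AddSubgroup.card_mul_index]
    have h2 := two_mul_card_traceZero (F := F)
    change Nat.card (traceZero F) ≤ _
    lia
  exact (AddSubgroup.eq_of_le_of_card_ge hle hcard).ge ht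

end Trace

/-! ### Quadratic forms on the plane -/

section PlaneForm

variable {F : Type*} [Field F]

variable (F) in
/-- The alternating bilinear form `v₀ w₁ + v₁ w₀` on the plane in characteristic two, which is the
polarization of every `PlaneForm`. -/
def polarForm : LinearMap.BilinForm F (Fin 2 → F) :=
  Matrix.toBilin' !![0, 1; 1, 0]

theorem polarForm_apply (v w : Fin 2 → F) : polarForm F v w = v 0 * w 1 + v 1 * w 0 := by
  simp [polarForm, Matrix.toBilin'_apply, Fin.sum_univ_two]

variable (F) in
/-- The quadratic form `a X² + X Y + b Y²` on the plane. In characteristic two, these are the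
quadratic forms whose polarization is `polarForm F`. -/
@[ext]
structure PlaneForm where
  a : F
  b : F

namespace PlaneForm

instance : FunLike (PlaneForm F) (Fin 2 → F) F where
  coe Q v := Q.a * v 0 ^ 2 + v 0 * v 1 + Q.b * v 1 ^ 2
  coe_injective Q Q' h := by
    ext
    · simpa using congrFun h ![1, 0]
    · simpa using congrFun h ![0, 1]

instance [Finite F] : Finite (PlaneForm F) :=
  DFunLike.finite _

theorem apply_def (Q : PlaneForm F) (v : Fin 2 → F) :
    Q v = Q.a * v 0 ^ 2 + v 0 * v 1 + Q.b * v 1 ^ 2 :=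
  rfl

protected theorem map_zero (Q : PlaneForm F) : Q 0 = 0 := by
  simp [apply_def]

protected theorem map_smul (Q : PlaneForm F) (c : F) (v : Fin 2 → F) : Q (c • v) = c ^ 2 * Q v := by
  simp only [apply_def, Pi.smul_apply, smul_eq_mul]
  ring

instance : VAdd (Fin 2 → F) (PlaneForm F) where
  vadd v Q := ⟨Q.a + v 1 ^ 2, Q.b + v 0 ^ 2⟩

theorem vadd_def (v : Fin 2 → F) (Q : PlaneForm F) :
    v +ᵥ Q = ⟨Q.a + v 1 ^ 2, Q.b + v 0 ^ 2⟩ :=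
  rfl

end PlaneForm

theorem polarForm_comm (v w : Fin 2 → F) : polarForm F v w = polarForm F w v := by
  simp only [polarForm_apply]
  ring

theorem exists_polarForm_eq_one {v : Fin 2 → F} (hv : v ≠ 0) : ∃ w, polarForm F v w = 1 := by
  by_cases h : v 0 = 0
  · have h' : v 1 ≠ 0 := fun h' => hv (by ext i; fin_cases i <;> assumption)
    exact ⟨![(v 1)⁻¹, 0], by simp [polarForm_apply, h']⟩
  · exact ⟨![0, (v 0)⁻¹], by simp [polarForm_apply, h]⟩

variable [CharP F 2]

theorem polarForm_self (v : Fin 2 → F) : polarForm F v v = 0 := by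
  rw [polarForm_apply]
  grind

theorem add_self_eq_zero (v : Fin 2 → F) : v + v = 0 :=
  funext fun i => CharTwo.add_self_eq_zero (v i)

theorem smul_add_smul_of_polarForm_eq_one {v w : Fin 2 → F} (h : polarForm F v w = 1)
    (u : Fin 2 → F) : polarForm F u w • v + polarForm F u v • w = u := by
  rw [polarForm_apply] at h
  ext i
  fin_cases i <;> simp [polarForm_apply] <;> grind

theorem exists_eq_smul_of_polarForm_eq_zero {v w : Fin 2 → F} (hw : w ≠ 0)
    (h : polarForm F v w = 0) : ∃ c : F, v = c • w := by
  obtain ⟨z, hz⟩ := exists_polarForm_eq_one hw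
  refine ⟨polarForm F v z, ?_⟩
  rw [← smul_add_smul_of_polarForm_eq_one hz v, h]
  simp [hz]

theorem polarForm_smul_smul (m : SL(2, F)) (v w : Fin 2 → F) :
    polarForm F (m • v) (m • w) = polarForm F v w := by
  have h := m.det_coe
  rw [Matrix.det_fin_two] at h
  simp only [polarForm_apply, Matrix.SpecialLinearGroup.smul_def]
  simp
  grind

theorem polarForm_inv_smul_right (m : SL(2, F)) (v w : Fin 2 → F) :
    polarForm F v (m⁻¹ • w) = polarForm F (m • v) w := by
  rw [← polarForm_smul_smul m, smul_inv_smul]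

namespace PlaneForm

protected theorem map_add (Q : PlaneForm F) (v w : Fin 2 → F) :
    Q (v + w) = Q v + Q w + polarForm F v w := by
  simp only [apply_def, polarForm_apply, Pi.add_apply]
  grind

instance : SMul SL(2, F) (PlaneForm F) where
  smul m Q := ⟨Q (m⁻¹ • ![1, 0]), Q (m⁻¹ • ![0, 1])⟩

theorem smul_apply (m : SL(2, F)) (Q : PlaneForm F) (v : Fin 2 → F) :
    (m • Q) v = Q (m⁻¹ • v) := by
  have hv : v = v 0 • ![1, 0] + v 1 • ![0, 1] := by
    ext i
    fin_cases i <;> simp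
  have hm : (m • Q) v =
      Q (m⁻¹ • ![1, 0]) * v 0 ^ 2 + v 0 * v 1 + Q (m⁻¹ • ![0, 1]) * v 1 ^ 2 := rfl
  conv_rhs => rw [hv, smul_add, smul_comm, smul_comm _ (v 1)]
  simp only [PlaneForm.map_add, PlaneForm.map_smul, LinearMap.map_smul, LinearMap.smul_apply,
    polarForm_smul_smul, hm]
  simp [polarForm_apply]
  ring

theorem smul_apply_smul (m : SL(2, F)) (Q : PlaneForm F) (v : Fin 2 → F) :
    (m • Q) (m • v) = Q v := by
  rw [smul_apply, inv_smul_smul]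

instance : MulAction SL(2, F) (PlaneForm F) where
  one_smul Q := DFunLike.ext _ _ fun v => by simp [smul_apply]
  mul_smul m n Q := DFunLike.ext _ _ fun v => by simp [smul_apply, mul_smul]

theorem vadd_apply (v : Fin 2 → F) (Q : PlaneForm F) (u : Fin 2 → F) :
    (v +ᵥ Q) u = Q u + polarForm F v u ^ 2 := by
  simp only [apply_def, vadd_def, polarForm_apply]
  grind

instance : AddAction (Fin 2 → F) (PlaneForm F) where
  zero_vadd Q := DFunLike.ext _ _ fun u => by simp [vadd_apply]
  add_vadd v w Q := DFunLike.ext _ _ fun u => by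
    simp [vadd_apply, add_pow_char, add_left_comm, add_comm]

theorem smul_vadd (m : SL(2, F)) (v : Fin 2 → F) (Q : PlaneForm F) :
    m • (v +ᵥ Q) = m • v +ᵥ m • Q :=
  DFunLike.ext _ _ fun u => by
    simp only [smul_apply, vadd_apply, polarForm_inv_smul_right]

variable [PerfectRing F 2]

noncomputable instance : AddTorsor (Fin 2 → F) (PlaneForm F) where
  nonempty := ⟨⟨0, 0⟩⟩
  vsub Q Q' := ![(frobeniusEquiv F 2).symm (Q.b - Q'.b), (frobeniusEquiv F 2).symm (Q.a - Q'.a)]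
  vsub_vadd' Q Q' := by
    ext <;> simp only [vadd_def] <;> simp [-map_sub]
  vadd_vsub' v Q := by
    ext i
    fin_cases i <;> simp [vadd_def]

theorem smul_vsub (m : SL(2, F)) (Q Q' : PlaneForm F) : m • (Q -ᵥ Q') = m • Q -ᵥ m • Q' := by
  rw [← vadd_vsub (m • (Q -ᵥ Q')) (m • Q'), ← smul_vadd, vsub_vadd]

theorem surjective (Q : PlaneForm F) : Function.Surjective Q := by
  intro x
  by_cases ha : Q.a = 0
  · exact ⟨![x - Q.b, 1], by simp [apply_def, ha]⟩
  · exact ⟨![(frobeniusEquiv F 2).symm (x / Q.a), 0], by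
      simp [apply_def, -map_div₀, mul_div_cancel₀ _ ha]⟩

end PlaneForm
end PlaneForm

/-! ### Elliptic forms and their labels -/

section Elliptic

variable {F : Type*} [Field F]

theorem exists_smul_eq_of_polarForm_eq_one [CharP F 2] {v w v' w' : Fin 2 → F}
    (h : polarForm F v w = 1) (h' : polarForm F v' w' = 1) :
    ∃ m : SL(2, F), m • v = v' ∧ m • w = w' := by
  have key : ∀ v w : Fin 2 → F, polarForm F v w = 1 →
      ∃ m : SL(2, F), m • ![1, 0] = v ∧ m • ![0, 1] = w := by
    intro v w h
    have hdet : (!![v 0, w 0; v 1, w 1]).det = 1 := by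
      rw [polarForm_apply] at h
      rw [Matrix.det_fin_two_of]
      grind
    obtain ⟨m, hm⟩ : ∃ m : SL(2, F), (m : Matrix (Fin 2) (Fin 2) F) = !![v 0, w 0; v 1, w 1] :=
      ⟨⟨_, hdet⟩, rfl⟩
    refine ⟨m, ?_, ?_⟩ <;> ext i <;> fin_cases i <;>
      simp [Matrix.SpecialLinearGroup.smul_def, hm]
  obtain ⟨m, rfl, rfl⟩ := key v w h
  obtain ⟨m', rfl, rfl⟩ := key v' w' h'
  exact ⟨m' * m⁻¹, by simp [mul_smul], by simp [mul_smul]⟩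

namespace PlaneForm

theorem ext_of_polarForm_eq_one [CharP F 2] {Q Q' : PlaneForm F} {v w : Fin 2 → F}
    (h : polarForm F v w = 1) (hv : Q v = Q' v) (hw : Q w = Q' w) : Q = Q' :=
  DFunLike.ext _ _ fun u => by
    rw [← smul_add_smul_of_polarForm_eq_one h u]
    simp only [PlaneForm.map_add, PlaneForm.map_smul, hv, hw]

section Label

variable [CharP F 2] [PerfectRing F 2]

/-- The label of the pair `(Q, v +ᵥ Q)` of forms is the value `Q v`. On the elliptic forms it
distinguishes the orbits of `SL(2, F)` on pairs. -/
noncomputable def label (Q Q' : PlaneForm F) : F :=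
  Q (Q' -ᵥ Q)

theorem label_vadd (Q : PlaneForm F) (v : Fin 2 → F) : label Q (v +ᵥ Q) = Q v := by
  rw [label, vadd_vsub]

theorem label_smul_smul (m : SL(2, F)) (Q Q' : PlaneForm F) :
    label (m • Q) (m • Q') = label Q Q' := by
  rw [label, ← smul_vsub, smul_apply_smul, label]

theorem label_vadd_vadd (Q : PlaneForm F) (v w : Fin 2 → F) :
    label (v +ᵥ Q) (w +ᵥ Q) = Q v + Q w + (polarForm F v w + polarForm F v w ^ 2) := by
  have hsub : w - v = v + w := by
    rw [sub_eq_iff_eq_add, add_right_comm, add_self_eq_zero, zero_add]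
  rw [label, vadd_vsub_vadd_cancel_right, hsub, vadd_apply, PlaneForm.map_add, LinearMap.map_add,
    polarForm_self, zero_add, add_assoc]

end Label

variable [Algebra (ZMod 2) F]

local notation "Tr" => Algebra.trace (ZMod 2) F

/-- The form `a X² + X Y + b Y²` is elliptic, that is, anisotropic, when its Arf invariant
`Tr (a b)` is nonzero. -/
def IsElliptic (Q : PlaneForm F) : Prop :=
  Tr (Q.a * Q.b) = 1

variable [Finite F] {Q Q' : PlaneForm F}

theorem trace_apply_mul_apply (Q : PlaneForm F) {v w : Fin 2 → F} (h : polarForm F v w = 1) :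
    Tr (Q v * Q w) = Tr (Q.a * Q.b) := by
  let k := Q.a * v 0 * w 0 + Q.b * v 1 * w 1 + v 1 * w 0
  have key : Q v * Q w = Q.a * Q.b + (k + k ^ 2) := by
    rw [polarForm_apply] at h
    simp only [apply_def, k]
    grind
  rw [key, map_add, trace_add_sq, add_zero]

theorem isElliptic_smul_iff (m : SL(2, F)) : (m • Q).IsElliptic ↔ Q.IsElliptic := by
  have h : polarForm F (m⁻¹ • ![1, 0]) (m⁻¹ • ![0, 1]) = 1 := by
    rw [polarForm_smul_smul]
    simp [polarForm_apply]
  exact iff_of_eq (congrArg (· = 1) (trace_apply_mul_apply Q h))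

theorem IsElliptic.eq_zero (hQ : Q.IsElliptic) {v : Fin 2 → F} (hv : Q v = 0) : v = 0 := by
  by_contra hv0
  obtain ⟨w, hw⟩ := exists_polarForm_eq_one hv0
  have h := trace_apply_mul_apply Q hw
  rw [hv, zero_mul, map_zero, hQ] at h
  exact zero_ne_one h

theorem exists_ne_zero_apply_eq_zero (hQ : ¬ Q.IsElliptic) : ∃ v, v ≠ 0 ∧ Q v = 0 := by
  by_cases hb : Q.b = 0
  · exact ⟨![0, 1], by simp, by simp [apply_def, hb]⟩
  · have htr : Tr (Q.a * Q.b) = 0 := not_not.1 fun h => hQ (Fin.eq_one_of_ne_zero _ h)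
    obtain ⟨k, hk⟩ := exists_add_sq_eq htr
    refine ⟨![Q.b, k], by simp [hb], ?_⟩
    simp only [apply_def, Matrix.cons_val_zero, Matrix.cons_val_one]
    grind

theorem IsElliptic.vadd_iff (hQ : Q.IsElliptic) {v : Fin 2 → F} :
    (v +ᵥ Q).IsElliptic ↔ Tr (Q v) = 0 := by
  have key : (v +ᵥ Q).a * (v +ᵥ Q).b =
      Q.a * Q.b + (Q v + (v 0 * v 1 + (v 0 * v 1) ^ 2)) := by
    simp only [vadd_def, apply_def]
    grind
  rw [IsElliptic, key, map_add, map_add, trace_add_sq, hQ, add_zero, add_eq_left]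

theorem IsElliptic.exists_polarForm_eq_one_apply_eq (hQ : Q.IsElliptic) {v : Fin 2 → F} {c : F}
    (hc : Tr (Q v * c) = 1) : ∃ w, polarForm F v w = 1 ∧ Q w = c := by
  have hv : Q v ≠ 0 := by
    intro h
    simp [h] at hc
  obtain ⟨w, hw⟩ := exists_polarForm_eq_one (v := v) fun h => hv (by rw [h, PlaneForm.map_zero])
  obtain ⟨k, hk⟩ := exists_add_sq_eq (t := Q v * c + Q v * Q w) (by
    rw [map_add, hc, trace_apply_mul_apply Q hw, hQ, CharTwo.add_self_eq_zero])
  refine ⟨w + (k / Q v) • v, ?_, ?_⟩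
  · simp [polarForm_self, hw]
  · rw [PlaneForm.map_add, PlaneForm.map_smul, LinearMap.map_smul, polarForm_comm, hw, smul_eq_mul]
    field_simp
    grind

theorem IsElliptic.exists_smul_eq (hQ : Q.IsElliptic) (hQ' : Q'.IsElliptic) {v v' : Fin 2 → F}
    (hv : Q v ≠ 0) (h : Q v = Q' v') : ∃ m : SL(2, F), m • Q = Q' ∧ m • v = v' := by
  obtain ⟨c, hc⟩ := Algebra.trace_surjective (ZMod 2) F 1
  obtain ⟨w, hw, hQw⟩ := hQ.exists_polarForm_eq_one_apply_eq (v := v) (c := c / Q v)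
    (by rw [mul_div_cancel₀ _ hv, hc])
  obtain ⟨w', hw', hQw'⟩ := hQ'.exists_polarForm_eq_one_apply_eq (v := v') (c := c / Q v)
    (by rw [← h, mul_div_cancel₀ _ hv, hc])
  obtain ⟨m, rfl, rfl⟩ := exists_smul_eq_of_polarForm_eq_one hw hw'
  exact ⟨m, ext_of_polarForm_eq_one hw' (by rw [smul_apply_smul, h])
    (by rw [smul_apply_smul, hQw, hQw']), rfl⟩

theorem IsElliptic.label_eq_zero_iff (hQ : Q.IsElliptic) : label Q Q' = 0 ↔ Q = Q' := by
  refine ⟨fun h => (vsub_eq_zero_iff_eq.1 (hQ.eq_zero h)).symm, ?_⟩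
  rintro rfl
  rw [label, vsub_self, PlaneForm.map_zero]

theorem IsElliptic.trace_label (hQ : Q.IsElliptic) (hQ' : Q'.IsElliptic) :
    Tr (label Q Q') = 0 := by
  rw [label, ← hQ.vadd_iff, vsub_vadd]
  exact hQ'

end PlaneForm

variable (F) in
/-- The elliptic forms on the plane, which model the points of the large Hollmann scheme. -/
abbrev EllipticForm [Algebra (ZMod 2) F] : Type _ :=
  {Q : PlaneForm F // Q.IsElliptic}

namespace EllipticForm

open PlaneForm

variable [Algebra (ZMod 2) F] [Finite F]

instance : MulAction SL(2, F) (EllipticForm F) where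
  smul m Q := ⟨m • Q.1, (isElliptic_smul_iff m).2 Q.2⟩
  one_smul _ := Subtype.ext (one_smul _ _)
  mul_smul m n Q := Subtype.ext (mul_smul m n Q.1)

theorem coe_smul (m : SL(2, F)) (Q : EllipticForm F) :
    ((m • Q : EllipticForm F) : PlaneForm F) = m • (Q : PlaneForm F) :=
  rfl

instance : Nonempty (EllipticForm F) :=
  (Algebra.trace_surjective (ZMod 2) F 1).elim fun c hc => ⟨⟨1, c⟩, by
    rwa [IsElliptic, one_mul]⟩

instance : MulAction.IsPretransitive SL(2, F) (EllipticForm F) where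
  exists_smul_eq Q Q' := by
    obtain ⟨v, hv⟩ := Q.1.surjective 1
    obtain ⟨v', hv'⟩ := Q'.1.surjective 1
    obtain ⟨m, hm, -⟩ := Q.2.exists_smul_eq Q'.2 (by rw [hv]; exact one_ne_zero) (hv.trans hv'.symm)
    exact ⟨m, Subtype.ext hm⟩

theorem exists_smul_eq_of_label_eq {Q₁ Q₂ Q₁' Q₂' : EllipticForm F}
    (h : label Q₁.1 Q₂.1 = label Q₁'.1 Q₂'.1) : ∃ m : SL(2, F), m • Q₁ = Q₁' ∧ m • Q₂ = Q₂' := by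
  by_cases h0 : label Q₁.1 Q₂.1 = 0
  · obtain rfl := Subtype.ext (Q₁.2.label_eq_zero_iff.1 h0)
    obtain rfl := Subtype.ext (Q₁'.2.label_eq_zero_iff.1 (h ▸ h0))
    obtain ⟨m, hm⟩ := MulAction.exists_smul_eq SL(2, F) Q₁ Q₁'
    exact ⟨m, hm, hm⟩
  · obtain ⟨m, hm, hv⟩ := Q₁.2.exists_smul_eq Q₁'.2 h0 h
    refine ⟨m, Subtype.ext hm, Subtype.ext ?_⟩
    rw [coe_smul, ← vsub_vadd Q₂.1 Q₁.1, smul_vadd, hv, hm, vsub_vadd]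

theorem exists_label_eq (Q : EllipticForm F) {x : F} (hx : Algebra.trace (ZMod 2) F x = 0) :
    ∃ Q' : EllipticForm F, label Q.1 Q'.1 = x := by
  obtain ⟨v, rfl⟩ := Q.1.surjective x
  exact ⟨⟨v +ᵥ Q.1, Q.2.vadd_iff.2 hx⟩, label_vadd _ _⟩

end EllipticForm

end Elliptic

/-! ### The stabilizer of an elliptic form -/

section OddOrder

variable {F : Type*} [Field F] {N : Subgroup SL(2, F)}

theorem eq_one_of_forall_smul_eq_self {m : SL(2, F)} (h : ∀ v : Fin 2 → F, m • v = v) :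
    m = 1 := by
  ext i j
  simpa [Matrix.SpecialLinearGroup.smul_def, Matrix.one_apply, Pi.single_apply, eq_comm] using
    congrFun (h (Pi.single j 1)) i

variable [CharP F 2]

-- If `n` fixes `v ≠ 0` then `n • w` and `w` differ by a multiple of `v`, so `n` is an involution.
theorem eq_one_of_smul_eq_self (hN : Odd (Nat.card N)) {n : SL(2, F)} (hn : n ∈ N)
    {v : Fin 2 → F} (hv : v ≠ 0) (h : n • v = v) : n = 1 := by
  have hsq : n ^ 2 = 1 := by
    refine eq_one_of_forall_smul_eq_self fun w => ?_
    obtain ⟨c, hc⟩ : ∃ c : F, n • w + w = c • v := by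
      refine exists_eq_smul_of_polarForm_eq_zero hv ?_
      have hnw : polarForm F (n • w) v = polarForm F w v := by
        rw [← polarForm_smul_smul n w v, h]
      rw [LinearMap.map_add, LinearMap.add_apply, hnw, CharTwo.add_self_eq_zero]
    have hnw : n • w = c • v + w := by
      rw [← hc, add_assoc, add_self_eq_zero, add_zero]
    rw [sq, mul_smul, hnw, smul_add, smul_comm, h, hnw, ← add_assoc, add_self_eq_zero, zero_add]
  have hodd : Odd (orderOf n) := hN.of_dvd_nat (N.orderOf_dvd_natCard hn)
  rw [← orderOf_eq_one_iff]
  exact Nat.eq_one_of_dvd_coprimes hodd.coprime_two_right dvd_rfl (orderOf_dvd_of_pow_eq_one hsq)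

namespace PlaneForm

variable [PerfectRing F 2]

-- The average of the orbit of any form, as an affine combination with coefficients `1`.
theorem exists_mem_fixedPoints (hN : Odd (Nat.card N)) :
    ∃ Q : PlaneForm F, Q ∈ MulAction.fixedPoints N (PlaneForm F) := by
  have : Finite N := Nat.finite_of_card_ne_zero hN.pos.ne'
  have := Fintype.ofFinite N
  obtain ⟨Q⟩ : Nonempty (PlaneForm F) := inferInstance
  refine ⟨(∑ n : N, (n • Q -ᵥ Q)) +ᵥ Q, fun m => ?_⟩
  have hodd (v : Fin 2 → F) : Nat.card N • v = v := by
    obtain ⟨k, hk⟩ := hN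
    rw [hk, succ_nsmul, mul_nsmul, two_nsmul, add_self_eq_zero, nsmul_zero, zero_add]
  have hperm : ∑ n : N, ((m * n) • Q -ᵥ Q) = ∑ n : N, (n • Q -ᵥ Q) :=
    Equiv.sum_comp (Equiv.mulLeft m) fun n => n • Q -ᵥ Q
  have hsum : m • ∑ n : N, (n • Q -ᵥ Q) = (∑ n : N, (n • Q -ᵥ Q)) - (m • Q -ᵥ Q) :=
    calc m • ∑ n : N, (n • Q -ᵥ Q)
      _ = ∑ n : N, (((m * n) • Q -ᵥ Q) - (m • Q -ᵥ Q)) := by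
        rw [Finset.smul_sum]
        refine Finset.sum_congr rfl fun n _ => ?_
        rw [vsub_sub_vsub_cancel_right, Subgroup.smul_def, smul_vsub, mul_smul]
        rfl
      _ = (∑ n : N, (n • Q -ᵥ Q)) - (m • Q -ᵥ Q) := by
        rw [Finset.sum_sub_distrib, Finset.sum_const, Finset.card_univ, ← Nat.card_eq_fintype_card,
          hodd, hperm]
  rw [Subgroup.smul_def, smul_vadd, ← Subgroup.smul_def, ← Subgroup.smul_def, hsum,
    ← vsub_vadd (m • Q) Q, vadd_vadd, vsub_vadd, sub_add_cancel]

theorem subsingleton_fixedPoints (hN : Odd (Nat.card N)) (hN' : N ≠ ⊥) :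
    (MulAction.fixedPoints N (PlaneForm F)).Subsingleton := by
  intro Q hQ Q' hQ'
  obtain ⟨n, hn, hn1⟩ := N.bot_or_exists_ne_one.resolve_left hN'
  by_contra hne
  refine hn1 (eq_one_of_smul_eq_self hN hn (vsub_ne_zero.2 hne) ?_)
  rw [smul_vsub]
  exact congrArg₂ _ (hQ ⟨n, hn⟩) (hQ' ⟨n, hn⟩)

end PlaneForm

end OddOrder

section Stabilizer

variable {F : Type*} [Field F]

namespace PlaneForm

theorem eq_of_polarForm_eq_of_apply_eq_zero [CharP F 2] {Q : PlaneForm F} {u v w : Fin 2 → F}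
    (hu : u ≠ 0) (hQu : Q u = 0) (hw : Q w ≠ 0) (hvw : Q v = Q w)
    (h : polarForm F v u = polarForm F w u) : v = w := by
  obtain ⟨c, hc⟩ : ∃ c : F, v - w = c • u :=
    exists_eq_smul_of_polarForm_eq_zero hu (by
      rw [LinearMap.map_sub, LinearMap.sub_apply, h, sub_self])
  obtain rfl := sub_eq_iff_eq_add'.1 hc
  have hwu : polarForm F w u ≠ 0 := by
    intro h0
    obtain ⟨d, rfl⟩ := exists_eq_smul_of_polarForm_eq_zero hu h0
    exact hw (by rw [PlaneForm.map_smul, hQu, mul_zero])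
  have hc0 : c * polarForm F w u = 0 := by
    rwa [PlaneForm.map_add, PlaneForm.map_smul, hQu, mul_zero, add_zero, LinearMap.map_smul,
      smul_eq_mul, add_eq_left] at hvw
  rw [(mul_eq_zero.1 hc0).resolve_right hwu, zero_smul, add_zero]

variable [Algebra (ZMod 2) F] [Finite F]

-- A nonzero singular vector `u` of `Q` would make `n ↦ B (n • v) u` injective on `N`, for any
-- `v` with `Q v = 1`.
theorem isElliptic_of_mem_fixedPoints {N : Subgroup SL(2, F)} (hN : Odd (Nat.card N))
    (hcard : Nat.card F < Nat.card N) {Q : PlaneForm F}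
    (hQ : Q ∈ MulAction.fixedPoints N (PlaneForm F)) : Q.IsElliptic := by
  by_contra hne
  obtain ⟨u, hu, hQu⟩ := exists_ne_zero_apply_eq_zero hne
  obtain ⟨v, hv⟩ := Q.surjective 1
  have hQv (n : N) : Q (n • v) = 1 := by
    rw [← hv, ← smul_apply_smul n.1 Q v]
    exact congrArg (fun Q' : PlaneForm F => Q' (n • v)) (hQ n).symm
  have hv0 : v ≠ 0 := by
    rintro rfl
    rw [PlaneForm.map_zero] at hv
    exact zero_ne_one hv
  have hinj : Function.Injective fun n : N => polarForm F (n • v) u := by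
    intro m n hmn
    have hmn' : m • v = n • v := eq_of_polarForm_eq_of_apply_eq_zero hu hQu
      (by rw [hQv]; exact one_ne_zero) (by rw [hQv, hQv]) hmn
    have hfix : (n⁻¹ * m) • v = v := by rw [mul_smul, hmn', inv_smul_smul]
    exact (inv_mul_eq_one.1 (Subtype.ext (eq_one_of_smul_eq_self hN (n⁻¹ * m).2 hv0 hfix))).symm
  exact hcard.not_ge (Nat.card_le_card_of_injective _ hinj)

end PlaneForm

theorem exists_normal_card_eq {H : Type*} [Group H] {k : ℕ} (hk : Odd k)
    (hH : Nat.card H = 2 * k) : ∃ N : Subgroup H, N.Normal ∧ Nat.card N = k := by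
  have : Finite H := Nat.finite_of_card_ne_zero (by have := hk.pos; lia)
  have hmin : (Nat.card H).minFac = 2 := by
    rw [hH, Nat.minFac_eq_two_iff]
    exact Dvd.intro _ rfl
  have := Fact.mk Nat.prime_two
  let P : Sylow 2 H := default
  have hP : Nat.card P = 2 := by
    rw [P.card_eq_multiplicity, hH, Nat.factorization_mul two_ne_zero hk.pos.ne']
    simp [Nat.prime_two.factorization_self,
      Nat.factorization_eq_zero_of_not_dvd hk.not_two_dvd_nat]
  have hcyc : IsCyclic P := isCyclic_of_prime_card hP
  have hc := (IsCyclic.isComplement' hmin hcyc).card_mul_card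
  have hP' : Nat.card (P : Subgroup H) = 2 := hP
  rw [hH, hP', mul_comm 2] at hc
  exact ⟨(MonoidHom.transferSylow P (hcyc.normalizer_le_centralizer hmin)).ker,
    MonoidHom.normal_ker _, Nat.eq_of_mul_eq_mul_right two_pos hc⟩

variable [Algebra (ZMod 2) F] [Finite F]

theorem even_card : Even (Nat.card F) :=
  ⟨_, (two_mul_card_traceZero (F := F)).symm.trans (two_mul _)⟩

-- The unique form fixed by a normal subgroup of order `q + 1` is fixed by the whole group.
theorem EllipticForm.exists_le_stabilizer {H : Subgroup SL(2, F)}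
    (hH : Nat.card H = 2 * (Nat.card F + 1)) :
    ∃ Q : EllipticForm F, H ≤ MulAction.stabilizer SL(2, F) Q := by
  have hodd : Odd (Nat.card F + 1) := even_card.add_one
  obtain ⟨N', hN', hcard'⟩ := exists_normal_card_eq hodd hH
  let N : Subgroup SL(2, F) := N'.map H.subtype
  have hcard : Nat.card N = Nat.card F + 1 := by
    rw [← hcard', Subgroup.card_subtype]
  have hN : Odd (Nat.card N) := hcard ▸ hodd
  have hne : N ≠ ⊥ := by
    rw [← Subgroup.one_lt_card_iff_ne_bot, hcard]
    exact Nat.lt_add_of_pos_left Nat.card_pos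
  obtain ⟨Q, hQ⟩ := PlaneForm.exists_mem_fixedPoints hN
  have hell := PlaneForm.isElliptic_of_mem_fixedPoints hN (by lia) hQ
  refine ⟨⟨Q, hell⟩, fun h hh => Subtype.ext ?_⟩
  refine PlaneForm.subsingleton_fixedPoints hN hne (fun n => ?_) hQ
  obtain ⟨_, n', hn', rfl⟩ := n
  have hconj : h⁻¹ * n' * h ∈ N := ⟨_, hN'.conj_mem' n' hn' ⟨h, hh⟩, rfl⟩
  calc (n' : SL(2, F)) • h • Q
    _ = h • (h⁻¹ * n' * h) • Q := by simp only [← mul_smul, mul_assoc, mul_inv_cancel_left]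
    _ = h • Q := congrArg (h • ·) (hQ ⟨_, hconj⟩)

end Stabilizer

/-! ### The point set as the set of elliptic forms -/

theorem exists_equiv_forall_apply_smul_eq {G X Y : Type*} [Group G] [MulAction G X] [MulAction G Y]
    [MulAction.IsPretransitive G X] [MulAction.IsPretransitive G Y] [Finite Y]
    (hcard : Nat.card X = Nat.card Y) {x : X} {y : Y}
    (h : MulAction.stabilizer G x ≤ MulAction.stabilizer G y) :
    ∃ e : X ≃ Y, ∀ (g : G) (z : X), e (g • z) = g • e z := by
  have hmap {g g' : G} (hg : g • x = g' • x) : g • y = g' • y := by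
    have hmem : g'⁻¹ * g ∈ MulAction.stabilizer G x := by
      rw [MulAction.mem_stabilizer_iff, mul_smul, hg, inv_smul_smul]
    rw [← inv_smul_eq_iff, ← mul_smul]
    exact h hmem
  choose g hg using fun z : X => MulAction.exists_smul_eq G x z
  have hf (m : G) : g (m • x) • y = m • y := hmap (hg _)
  have hbij : Function.Bijective fun z => g z • y := by
    have : Finite X := Nat.finite_of_card_ne_zero <| hcard ▸ Nat.card_ne_zero.2 ⟨⟨y⟩, ‹_›⟩
    refine (Nat.bijective_iff_surjective_and_card _).2 ⟨fun z => ?_, hcard⟩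
    obtain ⟨m, rfl⟩ := MulAction.exists_smul_eq G y z
    exact ⟨m • x, hf m⟩
  refine ⟨Equiv.ofBijective _ hbij, fun m z => ?_⟩
  simp only [Equiv.ofBijective_apply]
  rw [← mul_smul, ← hf (m * g z), mul_smul, hg]

section Model

variable {F : Type*} [Field F] [Finite F]

theorem card_specialLinearGroup_two :
    Nat.card SL(2, F) = Nat.card F * (Nat.card F - 1) * (Nat.card F + 1) := by
  have := Fintype.ofFinite F
  let det : GL (Fin 2) F →* Fˣ := Matrix.GeneralLinearGroup.det
  have hker : Nat.card det.ker = Nat.card SL(2, F) := by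
    rw [← Nat.card_range_of_injective Matrix.SpecialLinearGroup.toGL_injective,
      Matrix.SpecialLinearGroup.range_toGL]
    rfl
  have hmul := det.ker.card_mul_index
  rw [Subgroup.index_ker, MonoidHom.range_eq_top.2 Matrix.GeneralLinearGroup.det_surjective,
    Subgroup.card_top, hker, Nat.card_units, Matrix.card_GL_field, Fin.prod_univ_two,
    ← Nat.card_eq_fintype_card] at hmul
  obtain ⟨k, hk⟩ := Nat.exists_eq_add_of_lt (Finite.one_lt_card (α := F))
  have hsub : (1 + k + 1) ^ 2 - 1 = (k + 1) * (k + 3) :=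
    Nat.sub_eq_of_eq_add (by ring)
  have hsub' : (1 + k + 1) ^ 2 - (1 + k + 1) = (k + 2) * (k + 1) :=
    Nat.sub_eq_of_eq_add (by ring)
  rw [hk, Nat.add_sub_cancel, Fin.val_zero, Fin.val_one, pow_zero, pow_one, hsub, hsub'] at hmul
  rw [hk, Nat.add_sub_cancel]
  exact Nat.eq_of_mul_eq_mul_right (Nat.add_pos_left one_pos k) (by rw [hmul]; ring)

variable [Algebra (ZMod 2) F]

theorem EllipticForm.natCard : Nat.card (EllipticForm F) = Nat.card F * (Nat.card F - 1) / 2 := by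
  obtain ⟨u, hu⟩ := Algebra.trace_surjective (ZMod 2) F 1
  let e : EllipticForm F ≃ {a : F // a ≠ 0} × traceZero F :=
    { toFun Q := (⟨Q.1.a, fun h => by simpa [PlaneForm.IsElliptic, h] using Q.2⟩,
        ⟨Q.1.a * Q.1.b - u, by rw [traceZero, LinearMap.mem_ker, map_sub, hu, Q.2, sub_self]⟩)
      invFun p := ⟨⟨p.1, (p.2 + u) / p.1⟩, by
        rw [PlaneForm.IsElliptic, mul_div_cancel₀ _ p.1.2, map_add, hu, p.2.2, zero_add]⟩
      left_inv Q := by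
        have ha : Q.1.a ≠ 0 := fun h => by simpa [PlaneForm.IsElliptic, h] using Q.2
        ext <;> simp [ha]
      right_inv p := by
        ext <;> simp [mul_div_cancel₀ _ p.1.2] }
  have hne : Nat.card {a : F // a ≠ 0} = Nat.card F - 1 := by
    rw [← Nat.card_units, Nat.card_congr unitsEquivNeZero]
  rw [Nat.card_congr e, Nat.card_prod, hne, ← two_mul_card_traceZero (F := F), mul_assoc,
    Nat.mul_div_cancel_left _ two_pos, mul_comm]

variable {Ω : Type*}

theorem EllipticForm.exists_equiv [MulAction SL(2, F) Ω] [MulAction.IsPretransitive SL(2, F) Ω]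
    (hΩ : Nat.card Ω = Nat.card F * (Nat.card F - 1) / 2) :
    ∃ e : Ω ≃ EllipticForm F, ∀ (m : SL(2, F)) (ω : Ω), e (m • ω) = m • e ω := by
  have hcard : Nat.card Ω = Nat.card (EllipticForm F) := by rw [hΩ, natCard]
  have hpos : 0 < Nat.card Ω := hcard ▸ Nat.card_pos
  obtain ⟨ω⟩ := (Nat.card_pos_iff.1 hpos).1
  have hstab : Nat.card (MulAction.stabilizer SL(2, F) ω) = 2 * (Nat.card F + 1) := by
    refine Nat.eq_of_mul_eq_mul_right hpos ?_
    have htwo : 2 * Nat.card Ω = Nat.card F * (Nat.card F - 1) := by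
      rw [hΩ, Nat.mul_div_cancel' (even_card.two_dvd.mul_right _)]
    have h := (MulAction.stabilizer SL(2, F) ω).card_mul_index
    rw [MulAction.index_stabilizer_of_transitive, card_specialLinearGroup_two, ← htwo] at h
    rw [h]
    ring
  obtain ⟨Q, hQ⟩ := exists_le_stabilizer hstab
  exact exists_equiv_forall_apply_smul_eq hcard hQ

/-- The bijection `e` from `Ω` onto the elliptic forms turns the elements of `G` into the maps
`Q ↦ m • Q` with `m` in `SL(2, F)`. -/
def IsEllipticModel (G : Subgroup (Equiv.Perm Ω)) (e : Ω ≃ EllipticForm F) : Prop :=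
  ∀ g : Equiv.Perm Ω, g ∈ G ↔ ∃ m : SL(2, F), ∀ ω, e (g ω) = m • e ω

theorem IsHollmannGroup.exists_isEllipticModel {G : Subgroup (Equiv.Perm Ω)}
    (hG : IsHollmannGroup F G) : ∃ e : Ω ≃ EllipticForm F, IsEllipticModel G e := by
  obtain ⟨i⟩ := hG.iso
  let φ : SL(2, F) →* G := i.symm.toMonoidHom.comp (QuotientGroup.mk' _)
  have hφ : Function.Surjective φ := i.symm.surjective.comp (QuotientGroup.mk'_surjective _)
  let : MulAction SL(2, F) Ω := MulAction.compHom Ω φ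
  have : MulAction.IsPretransitive SL(2, F) Ω := ⟨fun ω ω' => by
    obtain ⟨g, hg⟩ := hG.transitive.exists_smul_eq ω ω'
    obtain ⟨m, rfl⟩ := hφ g
    exact ⟨m, hg⟩⟩
  obtain ⟨e, he⟩ := EllipticForm.exists_equiv hG.degree
  refine ⟨e, fun g => ⟨fun hg => ?_, ?_⟩⟩
  · obtain ⟨m, hm⟩ := hφ ⟨g, hg⟩
    exact ⟨m, fun ω => by rw [← he]; exact congrArg (fun g : G => e (g.1 ω)) hm.symm⟩
  · rintro ⟨m, hm⟩
    have hg : g = (φ m).1 := Equiv.ext fun ω => e.injective ((hm ω).trans (he m ω).symm)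
    exact hg ▸ (φ m).2

end Model

/-! ### The labelling of the basis relations -/

section Labelling

variable {F : Type*} [Field F]

namespace PlaneForm

variable {Q : PlaneForm F}

theorem ne_zero_of_apply_ne_zero {v : Fin 2 → F} (hv : Q v ≠ 0) : v ≠ 0 :=
  fun h => hv (by rw [h, PlaneForm.map_zero])

theorem eq_smul_of_polarForm_eq_zero [CharP F 2] {v w : Fin 2 → F} {k : F} (hv : Q v ≠ 0)
    (hwv : polarForm F w v = 0) (h : Q w = k ^ 2 * Q v) : w = k • v := by
  obtain ⟨c, rfl⟩ := exists_eq_smul_of_polarForm_eq_zero (ne_zero_of_apply_ne_zero hv) hwv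
  rw [PlaneForm.map_smul] at h
  rw [frobenius_inj F 2 (mul_right_cancel₀ hv h)]

theorem apply_reflection [CharP F 2] {w : Fin 2 → F} (hw : Q w ≠ 0) (v : Fin 2 → F) :
    Q (v + (polarForm F v w / Q w) • w) = Q v := by
  rw [PlaneForm.map_add, PlaneForm.map_smul, LinearMap.map_smul, smul_eq_mul]
  field_simp
  grind

end PlaneForm

variable [Algebra (ZMod 2) F] [Finite F]

local notation "Tr" => Algebra.trace (ZMod 2) F

namespace PlaneForm

variable {Q : PlaneForm F}

-- Reflection in `w` preserves the condition on `v`, so a unique solution is a multiple of `w`.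
theorem IsElliptic.existsUnique_apply_eq_and_polarForm_iff (hQ : Q.IsElliptic) {w : Fin 2 → F}
    (hw : Q w ≠ 0) (x t : F) :
    (∃! v, Q v = x ∧ polarForm F v w + polarForm F v w ^ 2 = t) ↔ Tr (x * Q w) = 0 ∧ t = 0 := by
  have hw0 := ne_zero_of_apply_ne_zero hw
  constructor
  · rintro ⟨v, ⟨rfl, rfl⟩, huniq⟩
    have hvw : polarForm F v w = 0 := by
      have h := huniq (v + (polarForm F v w / Q w) • w)
        ⟨apply_reflection hw v, by simp [polarForm_self]⟩
      exact (div_eq_zero_iff.1 ((smul_eq_zero.1 (add_eq_left.1 h)).resolve_right hw0)).resolve_right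
        hw
    refine ⟨by_contra fun htr => ?_, add_sq_eq_zero_iff.2 (.inl hvw)⟩
    obtain ⟨u, hwu, hQu⟩ := hQ.exists_polarForm_eq_one_apply_eq (v := w) (c := Q v)
      (by rw [mul_comm]; exact Fin.eq_one_of_ne_zero _ htr)
    rw [polarForm_comm] at hwu
    have huv : u = v := huniq u ⟨hQu, by
      rw [add_sq_eq_zero_iff.2 (.inr hwu), add_sq_eq_zero_iff.2 (.inl hvw)]⟩
    rw [huv, hvw] at hwu
    exact zero_ne_one hwu
  · rintro ⟨htr, rfl⟩
    obtain ⟨k, hk⟩ : ∃ k : F, k ^ 2 = x / Q w := surjective_frobenius F 2 _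
    have hkw : Q (k • w) = x := by rw [PlaneForm.map_smul, hk, div_mul_cancel₀ _ hw]
    refine ⟨k • w, ⟨hkw, by simp [polarForm_self]⟩, ?_⟩
    rintro u ⟨hQu, hu⟩
    rcases add_sq_eq_zero_iff.1 hu with hu | hu
    · exact eq_smul_of_polarForm_eq_zero hw hu (by rw [hQu, ← hkw, PlaneForm.map_smul])
    · rw [← hQu, trace_apply_mul_apply Q hu, hQ] at htr
      exact absurd htr one_ne_zero

end PlaneForm

theorem pathCount_eq_one_iff {Ω : Type*} {r s : Set (Ω × Ω)} {α β : Ω} :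
    pathCount r s α β = 1 ↔ ∃! δ, (α, δ) ∈ r ∧ (δ, β) ∈ s := by
  rw [pathCount, Set.ncard_eq_one, Set.singleton_iff_unique_mem]
  rfl

variable {Ω : Type*} {e : Ω ≃ EllipticForm F} {α β γ : Ω}

/-- The vector `v` such that the form of `β` is the translate by `v` of the form of `α`, which
serves as a coordinate of `β` with respect to the base point `α`. -/
noncomputable def vec (e : Ω ≃ EllipticForm F) (α β : Ω) : Fin 2 → F :=
  (e β).1 -ᵥ (e α).1

/-- The pairs of points whose forms have label `x`, which is the relation `s_x` of the paper. -/
def labelRel (e : Ω ≃ EllipticForm F) (x : F) : Set (Ω × Ω) :=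
  {p | (e p.1).1.label (e p.2).1 = x}

theorem vec_injective (e : Ω ≃ EllipticForm F) (α : Ω) : Function.Injective (vec e α) :=
  fun _ _ h => e.injective (Subtype.ext (vsub_left_injective _ h))

theorem exists_vec_eq (e : Ω ≃ EllipticForm F) (α : Ω) {v : Fin 2 → F}
    (hv : Tr ((e α).1 v) = 0) : ∃ β, vec e α β = v :=
  ⟨e.symm ⟨v +ᵥ (e α).1, (e α).2.vadd_iff.2 hv⟩, by
    rw [vec, Equiv.apply_symm_apply, vadd_vsub]⟩

theorem existsUnique_vec_iff (e : Ω ≃ EllipticForm F) (α : Ω) {P : (Fin 2 → F) → Prop}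
    (hP : ∀ v, P v → Tr ((e α).1 v) = 0) : (∃! δ, P (vec e α δ)) ↔ ∃! v, P v := by
  constructor
  · rintro ⟨δ, hδ, huniq⟩
    refine ⟨vec e α δ, hδ, fun v hv => ?_⟩
    obtain ⟨ε, rfl⟩ := exists_vec_eq e α (hP v hv)
    rw [huniq ε hv]
  · rintro ⟨v, hv, huniq⟩
    obtain ⟨δ, rfl⟩ := exists_vec_eq e α (hP v hv)
    exact ⟨δ, hv, fun ε hε => vec_injective e α (huniq _ hε)⟩

theorem mem_labelRel_iff {x : F} : (α, β) ∈ labelRel e x ↔ (e α).1 (vec e α β) = x :=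
  Iff.rfl

theorem mem_labelRel_iff_of_base (α : Ω) {x : F} :
    (β, γ) ∈ labelRel e x ↔ (e α).1 (vec e α β) + (e α).1 (vec e α γ) +
      (polarForm F (vec e α β) (vec e α γ) + polarForm F (vec e α β) (vec e α γ) ^ 2) = x := by
  rw [← PlaneForm.label_vadd_vadd, vec, vec, vsub_vadd, vsub_vadd]
  rfl

theorem exists_mem_labelRel (e : Ω ≃ EllipticForm F) (α : Ω) {x : F} (hx : Tr x = 0) :
    ∃ β, (α, β) ∈ labelRel e x := by
  obtain ⟨Q, hQ⟩ := (e α).exists_label_eq hx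
  exact ⟨e.symm Q, by rwa [labelRel, Set.mem_ofPred_eq, Equiv.apply_symm_apply]⟩

theorem labelRel_zero : labelRel e 0 = Set.diagonal Ω :=
  Set.ext fun p => (e p.1).2.label_eq_zero_iff.trans
    (Subtype.coe_injective.eq_iff.trans e.injective.eq_iff)

theorem pathCount_labelRel_eq_one_iff {x y z : F} (hx : Tr x = 0) (hz : z ≠ 0)
    (h : (β, γ) ∈ labelRel e z) :
    pathCount (labelRel e x) (labelRel e y) β γ = 1 ↔ Tr (x * z) = 0 ∧ x + y + z = 0 := by
  rw [mem_labelRel_iff] at h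
  have hy (v : Fin 2 → F) : (e β).1 v = x ∧ (e β).1 v + z +
      (polarForm F v (vec e β γ) + polarForm F v (vec e β γ) ^ 2) = y ↔
      (e β).1 v = x ∧ polarForm F v (vec e β γ) + polarForm F v (vec e β γ) ^ 2 = x + y + z := by
    grind
  rw [← h, ← (e β).2.existsUnique_apply_eq_and_polarForm_iff (h ▸ hz), pathCount_eq_one_iff, h]
  refine Iff.trans ?_ (existsUnique_vec_iff e β fun v hv => hv.1 ▸ hx)
  simp only [mem_labelRel_iff_of_base (γ := γ) β, mem_labelRel_iff, h, hy]

variable {G : Subgroup (Equiv.Perm Ω)}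

theorem IsEllipticModel.orbit_eq (he : IsEllipticModel G e) (p : Ω × Ω) :
    MulAction.orbit G p = labelRel e ((e p.1).1.label (e p.2).1) := by
  ext q
  constructor
  · rintro ⟨g, rfl⟩
    obtain ⟨m, hm⟩ := (he g).1 g.2
    change (e (g.1 p.1)).1.label (e (g.1 p.2)).1 = _
    rw [hm, hm, EllipticForm.coe_smul, EllipticForm.coe_smul, PlaneForm.label_smul_smul]
  · intro hq
    obtain ⟨m, h₁, h₂⟩ := EllipticForm.exists_smul_eq_of_label_eq (Eq.symm hq)
    let g : Equiv.Perm Ω := e.trans ((MulAction.toPerm m).trans e.symm)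
    have hg (ω : Ω) : e (g ω) = m • e ω := e.apply_symm_apply _
    exact ⟨⟨g, (he g).2 ⟨m, hg⟩⟩, Prod.ext (e.injective ((hg _).trans h₁))
      (e.injective ((hg _).trans h₂))⟩

theorem IsEllipticModel.isHollmannLabelling (he : IsEllipticModel G e) :
    IsHollmannLabelling (inv G) fun x : traceZero F => labelRel e (x : F) where
  bijOn := by
    obtain ⟨α⟩ : Nonempty Ω := e.nonempty
    refine ⟨fun x _ => ?_, fun x _ y _ hxy => ?_, ?_⟩
    · obtain ⟨β, hβ⟩ := exists_mem_labelRel e α x.2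
      exact ⟨(α, β), (he.orbit_eq _).trans (congrArg (labelRel e) hβ)⟩
    · obtain ⟨β, hβ⟩ := exists_mem_labelRel e α x.2
      have hβ' : (α, β) ∈ labelRel e (y : F) := hxy.subset hβ
      exact Subtype.ext (hβ.symm.trans hβ')
    · rintro _ ⟨p, rfl⟩
      exact ⟨⟨_, (e p.1).2.trace_label (e p.2).2⟩, Set.mem_univ _, (he.orbit_eq p).symm⟩
  zero := labelRel_zero
  intersection x y z hz β γ h := by
    rw [pathCount_labelRel_eq_one_iff x.2 (by simpa using hz) h, ← Submodule.coe_add,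
      ← Submodule.coe_add, ZeroMemClass.coe_eq_zero]

end Labelling

/-! ### Relations of coherent configurations and of their point extensions -/

theorem mem_diagOn {Ω : Type*} {Δ : Set Ω} {β γ : Ω} :
    (β, γ) ∈ diagOn Δ ↔ β = γ ∧ β ∈ Δ :=
  Iff.rfl

namespace CoherentConfiguration

open scoped SetRel

variable {Ω : Type*} {X Y : CoherentConfiguration Ω} {r s : Set (Ω × Ω)} {α : Ω}

theorem mem_relations_of_mem_basis (hr : r ∈ X.basis) : r ∈ X.relations :=
  ⟨{r}, Set.singleton_subset_iff.2 hr, (Set.sUnion_singleton r).symm⟩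

theorem subset_of_mem_basis (hr : r ∈ X.basis) (hs : s ∈ X.relations) {p : Ω × Ω} (hp : p ∈ r)
    (hp' : p ∈ s) : r ⊆ s :=
  fun q hq => (mem_unions_iff X.isPartition).1 hs r hr p hp q hq hp'

theorem inter_mem_relations (hr : r ∈ X.relations) (hs : s ∈ X.relations) :
    r ∩ s ∈ X.relations :=
  (mem_unions_iff X.isPartition).2 fun _ ht _ hp _ hq hpq =>
    ⟨subset_of_mem_basis ht hr hp hpq.1 hq, subset_of_mem_basis ht hs hp hpq.2 hq⟩

theorem relStar_mem_basis (hr : r ∈ X.basis) : relStar r ∈ X.basis :=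
  X.star_eq.subset ⟨r, hr, rfl⟩

theorem relStar_mem_relations (hr : r ∈ X.relations) : relStar r ∈ X.relations :=
  (mem_unions_iff X.isPartition).2 fun _ ht p hp q hq hpr =>
    subset_of_mem_basis (relStar_mem_basis ht) hr (p := p.swap) hp hpr (a := q.swap) hq

theorem diagonal_mem_relations : Set.diagonal Ω ∈ X.relations := by
  have h : Set.diagonal Ω = diagOn Set.univ := by
    ext
    simp [diagOn]
  rw [h]
  exact X.diag_mem

theorem mem_basis_of_le (hXY : X ≤ Y) (hr : r ∈ X.relations) (hr' : r ∈ Y.basis) :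
    r ∈ X.basis := by
  obtain ⟨p, hp⟩ : r.Nonempty :=
    Set.nonempty_iff_ne_empty.2 fun h => Y.isPartition.1 (h ▸ hr')
  obtain ⟨t, ⟨ht, hpt⟩, -⟩ := X.isPartition.2 p
  have htr : t = r := (subset_of_mem_basis ht hr hpt hp).antisymm
    (subset_of_mem_basis hr' (hXY (mem_relations_of_mem_basis ht)) hp hpt)
  exact htr ▸ ht

section Finite

variable [Finite Ω]

theorem setOf_pathCount_mem_relations (hr : r ∈ X.relations) (hs : s ∈ X.relations)
    (P : ℕ → Prop) : {p : Ω × Ω | P (pathCount r s p.1 p.2)} ∈ X.relations :=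
  (mem_unions_iff X.isPartition).2 fun _ ht _ hp _ hq h => by
    rwa [Set.mem_ofPred_eq, ← pathCount_congr X hr hs ht hp hq]

theorem comp_mem_relations (hr : r ∈ X.relations) (hs : s ∈ X.relations) :
    r ○ s ∈ X.relations := by
  have h : r ○ s = {p : Ω × Ω | pathCount r s p.1 p.2 ≠ 0} := by
    ext p
    rw [Set.mem_ofPred_eq, pathCount, Ne, Set.ncard_eq_zero, ← Ne, ← Set.nonempty_iff_ne_empty]
    rfl
  rw [h]
  exact setOf_pathCount_mem_relations hr hs (· ≠ 0)

theorem nbr_prod_nbr_mem_relations (hα : diagOn {α} ∈ X.relations) (hr : r ∈ X.relations)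
    (hs : s ∈ X.relations) : nbr α r ×ˢ nbr α s ∈ X.relations := by
  have h : nbr α r ×ˢ nbr α s = relStar r ○ diagOn {α} ○ s := by
    ext ⟨β, γ⟩
    constructor
    · rintro ⟨hβ, hγ⟩
      exact ⟨α, ⟨α, hβ, rfl, rfl⟩, hγ⟩
    · rintro ⟨α', ⟨α'', hβ, hα'⟩, hγ⟩
      obtain ⟨rfl, rfl⟩ := mem_diagOn.1 hα'
      exact ⟨hβ, hγ⟩
  rw [h]
  exact comp_mem_relations (comp_mem_relations (relStar_mem_relations hr) hα) hs

theorem mem_basis_of_existsUnique {Δ : Set Ω} (hΔ : Δ ∈ X.fibers) (hr : r ∈ X.relations)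
    (hsub : ∀ p ∈ r, p.1 ∈ Δ) (huniq : ∀ δ ∈ Δ, ∃! γ, (δ, γ) ∈ r) : r ∈ X.basis := by
  obtain ⟨⟨δ, δ'⟩, -, hδ⟩ : (diagOn Δ).Nonempty :=
    Set.nonempty_iff_ne_empty.2 fun h => X.isPartition.1 (h ▸ hΔ)
  obtain ⟨γ, hγ, -⟩ := huniq δ hδ
  obtain ⟨t, ⟨ht, hγt⟩, -⟩ := X.isPartition.2 (δ, γ)
  have htr : t ⊆ r := subset_of_mem_basis ht hr hγt hγ
  have ht' := mem_relations_of_mem_basis ht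
  have hdom : diagOn Δ ⊆ t ○ relStar t :=
    subset_of_mem_basis hΔ (comp_mem_relations ht' (relStar_mem_relations ht'))
      (p := (δ, δ)) ⟨rfl, hδ⟩ ⟨γ, hγt, hγt⟩
  have hrt : r ⊆ t := by
    rintro ⟨β, γ⟩ h
    obtain ⟨γ', hγ', -⟩ := hdom (a := (β, β)) ⟨rfl, hsub (β, γ) h⟩
    rwa [(huniq β (hsub _ h)).unique h (htr hγ')]
  exact (htr.antisymm hrt) ▸ ht

theorem isMatching_of_existsUnique {Δ Γ : Set Ω} (hΔ : Δ ∈ X.fibers) (hΓ : Γ ∈ X.fibers)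
    (hr : r ∈ X.relations) (hsub : r ⊆ Δ ×ˢ Γ) (hright : ∀ δ ∈ Δ, ∃! γ, (δ, γ) ∈ r)
    (hleft : ∀ γ ∈ Γ, ∃! δ, (δ, γ) ∈ r) : r ∈ X.basisBetween Δ Γ ∧ X.IsMatching r := by
  have hbasis := mem_basis_of_existsUnique hΔ hr (fun p hp => (hsub hp).1) hright
  have hncard {A : Set Ω} (h : ∃! δ, δ ∈ A) : A.ncard = 1 :=
    Set.ncard_eq_one.2 ((Set.singleton_iff_unique_mem).2 h)
  exact ⟨⟨hbasis, hsub⟩, hbasis,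
    ⟨Δ, hΔ, Γ, hΓ, ⟨hbasis, hsub⟩, fun δ hδ => hncard (hright δ hδ)⟩,
    ⟨Γ, hΓ, Δ, hΔ, ⟨relStar_mem_basis hbasis, fun _ hp => (hsub hp).symm⟩,
      fun γ hγ => hncard (hleft γ hγ)⟩⟩

theorem basis_subset_relations_pointExtension (X : CoherentConfiguration Ω) (α : Ω) :
    X.basis ⊆ (X.pointExtension α).relations :=
  Set.subset_union_left.trans (coherentClosure_isLeast (X.basis ∪ {diagOn {α}})).1

theorem diagOn_singleton_mem_relations_pointExtension (X : CoherentConfiguration Ω) (α : Ω) :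
    diagOn {α} ∈ (X.pointExtension α).relations :=
  (coherentClosure_isLeast (X.basis ∪ {diagOn {α}})).1 (.inr rfl)

end Finite

end CoherentConfiguration

section PermGroup

open CoherentConfiguration

variable {Ω : Type*} {G : Subgroup (Equiv.Perm Ω)} {s : Set (Ω × Ω)} {α β : Ω}

theorem mem_relations_inv_iff : s ∈ (inv G).relations ↔ ∀ g ∈ G, ∀ p ∈ s, g • p ∈ s := by
  refine (mem_unions_iff (inv G).isPartition).trans ⟨fun h g hg p hp => ?_, fun h => ?_⟩
  · exact h _ ⟨p, rfl⟩ p (MulAction.mem_orbit_self p) _ ⟨⟨g, hg⟩, rfl⟩ hp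
  · rintro _ ⟨p, rfl⟩ _ ⟨g, rfl⟩ _ ⟨k, rfl⟩ hg
    have hk := h _ (k * g⁻¹).2 _ hg
    rwa [← Subgroup.smul_def, ← mul_smul, inv_mul_cancel_right] at hk

theorem nbr_eq_orbit (hs : s ∈ (inv G).basis) (hβ : β ∈ nbr α s) :
    nbr α s = MulAction.orbit ↥(G ⊓ MulAction.stabilizer (Equiv.Perm Ω) α) β := by
  have hs' : s = MulAction.orbit G (α, β) := by
    obtain ⟨p, rfl⟩ := hs
    exact (MulAction.orbit_eq_iff.2 hβ).symm
  ext γ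
  rw [hs']
  constructor
  · rintro ⟨g, hg⟩
    exact ⟨⟨g, g.2, congrArg Prod.fst hg⟩, congrArg Prod.snd hg⟩
  · rintro ⟨g, rfl⟩
    exact ⟨⟨g, g.2.1⟩, Prod.ext g.2.2 rfl⟩

variable [Finite Ω]

theorem pointExtension_inv_le (G : Subgroup (Equiv.Perm Ω)) (α : Ω) :
    (inv G).pointExtension α ≤ inv (G ⊓ MulAction.stabilizer (Equiv.Perm Ω) α) := by
  refine (coherentClosure_isLeast _).2 ?_
  rintro t (ht | rfl) <;> refine mem_relations_inv_iff.2 fun g hg ⟨β, γ⟩ hp => ?_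
  · exact mem_relations_inv_iff.1 (mem_relations_of_mem_basis ht) g hg.1 (β, γ) hp
  · obtain ⟨rfl, rfl⟩ := mem_diagOn.1 hp
    exact ⟨rfl, hg.2⟩

theorem nbr_mem_fibers (hs : s ∈ (inv G).basis) (hne : (nbr α s).Nonempty) :
    nbr α s ∈ ((inv G).pointExtension α).fibers := by
  refine mem_basis_of_le (pointExtension_inv_le G α) ?_ ?_
  · have h : diagOn (nbr α s) = nbr α s ×ˢ nbr α s ∩ Set.diagonal Ω := by
      ext ⟨β, γ⟩
      constructor
      · intro h
        obtain ⟨rfl, hβ⟩ := mem_diagOn.1 h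
        exact ⟨⟨hβ, hβ⟩, rfl⟩
      · rintro ⟨⟨hβ, -⟩, h⟩
        exact ⟨h, hβ⟩
    have hs' := basis_subset_relations_pointExtension (inv G) α hs
    rw [h]
    exact inter_mem_relations (nbr_prod_nbr_mem_relations
      (diagOn_singleton_mem_relations_pointExtension _ α) hs' hs') diagonal_mem_relations
  · obtain ⟨β, hβ⟩ := hne
    rw [nbr_eq_orbit hs hβ]
    refine ⟨(β, β), Set.ext fun ⟨γ, γ'⟩ => ?_⟩
    constructor
    · rintro ⟨g, hg⟩
      obtain ⟨rfl, rfl⟩ := Prod.mk.inj hg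
      exact ⟨rfl, g, rfl⟩
    · intro h
      obtain ⟨rfl, g, rfl⟩ := mem_diagOn.1 h
      exact ⟨g, rfl⟩

end PermGroup

/-! ### Matchings in the point extension -/

section Matching

open CoherentConfiguration
open scoped SetRel

variable {F : Type*} [Field F]

namespace PlaneForm

variable {Q : PlaneForm F} {k : F} {u v w : Fin 2 → F}

/-- The vector `u` is the midpoint of a path from `v` to `w`. The number of such `u` tells `k • v`
apart from the vectors `w` with `Q w = Q (k • v)` and `polarForm F v w = 1`. -/
def IsLink (Q : PlaneForm F) (k : F) (v w u : Fin 2 → F) : Prop :=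
  Q u = Q w ∧ polarForm F v u + polarForm F v u ^ 2 = 0 ∧
    polarForm F u w + polarForm F u w ^ 2 = k + k ^ 2

variable [CharP F 2]

-- The reflection of a link in `v` is another link.
theorem not_existsUnique_isLink_smul (hv : Q v ≠ 0) (hk : k + k ^ 2 ≠ 0) :
    ¬∃! u, Q.IsLink k v (k • v) u := by
  rintro ⟨u, ⟨hQu, hvu, huw⟩, huniq⟩
  have hvu1 : polarForm F v u = 1 := (add_sq_eq_zero_iff.1 hvu).resolve_left fun h => by
    rw [polarForm_comm, map_smul, LinearMap.smul_apply, h] at huw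
    exact hk (by simpa using huw.symm)
  have hrefl := huniq (u + (polarForm F u v / Q v) • v)
    ⟨(apply_reflection hv u).trans hQu, by simpa [polarForm_self] using hvu,
      by simpa [polarForm_self] using huw⟩
  rw [polarForm_comm, hvu1, add_eq_left, smul_eq_zero] at hrefl
  exact hrefl.elim (one_div_ne_zero hv) (ne_zero_of_apply_ne_zero hv)

theorem IsLink.eq_smul (hu : Q.IsLink k v w u) (hv : Q v ≠ 0) (hw : Q w = k ^ 2 * Q v)
    (hvw : polarForm F v w = 1) (hk : k + k ^ 2 ≠ 0) (hkv : k * Q v ≠ 1)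
    (hkv' : (k + 1) * Q v ≠ 1) : u = k • v := by
  obtain ⟨hQu, hvu, huw⟩ := hu
  rcases add_sq_eq_zero_iff.1 hvu with hvu | hvu
  · exact eq_smul_of_polarForm_eq_zero hv (polarForm_comm u v ▸ hvu) (hQu.trans hw)
  obtain ⟨l, hl⟩ : ∃ l, u - w = l • v := by
    refine exists_eq_smul_of_polarForm_eq_zero (ne_zero_of_apply_ne_zero hv) ?_
    rw [polarForm_comm, map_sub, hvu, hvw, sub_self]
  obtain rfl : u = l • v + w := sub_eq_iff_eq_add.1 hl
  have hlw : polarForm F (l • v + w) w = l := by simp [polarForm_self, hvw]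
  have hQl : l * (l * Q v + 1) = 0 := by
    rw [PlaneForm.map_add, PlaneForm.map_smul] at hQu
    simp only [map_smul, LinearMap.smul_apply, hvw, smul_eq_mul] at hQu
    grind
  have hlk : l = k ∨ l = k + 1 := by
    rw [hlw] at huw
    have : (l + k) + (l + k) ^ 2 = 0 := by grind
    grind [add_sq_eq_zero_iff.1 this]
  rcases hlk with rfl | rfl <;> grind

theorem existsUnique_isLink (hv : Q v ≠ 0) (hw : Q w = k ^ 2 * Q v)
    (hvw : polarForm F v w = 1) (hk : k + k ^ 2 ≠ 0) (hkv : k * Q v ≠ 1)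
    (hkv' : (k + 1) * Q v ≠ 1) : ∃! u, Q.IsLink k v w u := by
  refine ⟨k • v, ⟨?_, ?_, ?_⟩, fun u hu => hu.eq_smul hv hw hvw hk hkv hkv'⟩
  · rw [PlaneForm.map_smul, hw]
  · simp [polarForm_self]
  · simp [hvw]

theorem eq_smul_iff_not_existsUnique_isLink (hv : Q v ≠ 0) (hw : Q w = k ^ 2 * Q v)
    (hvw : polarForm F v w + polarForm F v w ^ 2 = 0) (hk : k + k ^ 2 ≠ 0) (hkv : k * Q v ≠ 1)
    (hkv' : (k + 1) * Q v ≠ 1) : w = k • v ↔ ¬∃! u, Q.IsLink k v w u := by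
  constructor
  · rintro rfl
    exact not_existsUnique_isLink_smul hv hk
  · intro h
    rcases add_sq_eq_zero_iff.1 hvw with hvw | hvw
    · exact eq_smul_of_polarForm_eq_zero hv (polarForm_comm w v ▸ hvw) hw
    · exact absurd (existsUnique_isLink hv hw hvw hk hkv hkv') h

end PlaneForm

variable [Algebra (ZMod 2) F] [Finite F] {Ω : Type*} {e : Ω ≃ EllipticForm F} {α β γ : Ω}
  {k t x y : F}

local notation "Tr" => Algebra.trace (ZMod 2) F

/-- The graph of `v ↦ k • v` on the vectors of value `x`, relative to the base point `α`. It is the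
matching of the theorem between the neighbourhoods labelled `x` and `k ^ 2 * x`. -/
def scalarRel (e : Ω ≃ EllipticForm F) (α : Ω) (x k : F) : Set (Ω × Ω) :=
  {p | (e α).1 (vec e α p.1) = x ∧ vec e α p.2 = k • vec e α p.1}

theorem scalarRel_subset (e : Ω ≃ EllipticForm F) (α : Ω) (x k : F) :
    scalarRel e α x k ⊆ nbr α (labelRel e x) ×ˢ nbr α (labelRel e (k ^ 2 * x)) := by
  rintro ⟨β, γ⟩ ⟨hβ, hγ⟩
  refine ⟨hβ, mem_labelRel_iff.2 ?_⟩
  rw [hγ, PlaneForm.map_smul, hβ]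

theorem relStar_scalarRel (e : Ω ≃ EllipticForm F) (α : Ω) (x : F) (hk : k ≠ 0) :
    relStar (scalarRel e α x k) = scalarRel e α (k ^ 2 * x) k⁻¹ := by
  ext ⟨γ, β⟩
  constructor
  · rintro ⟨hβ, hγ⟩
    refine ⟨?_, (inv_smul_eq_iff₀ hk).2 hγ |>.symm⟩
    rw [hγ, PlaneForm.map_smul, hβ]
  · rintro ⟨hγ, hβ⟩
    have hγ' := (eq_inv_smul_iff₀ hk).1 hβ
    refine ⟨?_, hγ'.symm⟩
    rw [← hγ', PlaneForm.map_smul] at hγ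
    exact mul_left_cancel₀ (pow_ne_zero 2 hk) hγ

theorem existsUnique_scalarRel (hkx : Tr (k ^ 2 * x) = 0) (hβ : β ∈ nbr α (labelRel e x)) :
    ∃! γ, (β, γ) ∈ scalarRel e α x k := by
  obtain ⟨γ, hγ⟩ := exists_vec_eq e α (v := k • vec e α β)
    (by rwa [PlaneForm.map_smul, mem_labelRel_iff.1 hβ])
  exact ⟨γ, ⟨hβ, hγ⟩, fun γ' hγ' => vec_injective e α (hγ'.2.trans hγ.symm)⟩

theorem scalarRel_comp_scalarRel (hkx : Tr (k ^ 2 * x) = 0) (l : F) :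
    scalarRel e α x k ○ scalarRel e α (k ^ 2 * x) l = scalarRel e α x (l * k) := by
  ext ⟨β, γ⟩
  constructor
  · rintro ⟨δ, ⟨hβ, hδ⟩, -, hγ⟩
    exact ⟨hβ, by rw [hγ, hδ, mul_smul]⟩
  · rintro ⟨hβ, hγ⟩
    obtain ⟨δ, hδ, -⟩ := existsUnique_scalarRel hkx hβ
    exact ⟨δ, hδ, (scalarRel_subset e α x k hδ).2, by rw [hγ, mul_smul, hδ.2]⟩

theorem scalarRel_one (e : Ω ≃ EllipticForm F) (α : Ω) (x : F) :
    scalarRel e α x 1 = nbr α (labelRel e x) ×ˢ nbr α (labelRel e x) ∩ Set.diagonal Ω := by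
  ext ⟨β, γ⟩
  constructor
  · intro h
    obtain rfl : γ = β := vec_injective e α (h.2.trans (one_smul F _))
    exact ⟨⟨h.1, h.1⟩, rfl⟩
  · rintro ⟨⟨hβ, -⟩, hβγ⟩
    obtain rfl : β = γ := hβγ
    exact ⟨hβ, (one_smul F _).symm⟩

/-- The pairs of points whose vectors relative to `α` have the values `x` and `y` and a product `b`
with `b + b ^ 2 = t`. -/
def pairRel (e : Ω ≃ EllipticForm F) (α : Ω) (x y t : F) : Set (Ω × Ω) :=
  {p | (e α).1 (vec e α p.1) = x ∧ (e α).1 (vec e α p.2) = y ∧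
    polarForm F (vec e α p.1) (vec e α p.2) + polarForm F (vec e α p.1) (vec e α p.2) ^ 2 = t}

theorem pairRel_eq (e : Ω ≃ EllipticForm F) (α : Ω) (x y t : F) :
    pairRel e α x y t = nbr α (labelRel e x) ×ˢ nbr α (labelRel e y) ∩ labelRel e (x + y + t) := by
  ext ⟨β, γ⟩
  refine Iff.trans ?_ and_assoc.symm
  refine and_congr_right fun hβ => and_congr_right fun hγ => ?_
  rw [mem_labelRel_iff_of_base α, hβ, hγ, add_right_inj]

theorem pathCount_pairRel_eq_one_iff (hy : Tr y = 0) (h : (β, γ) ∈ pairRel e α x y t) (k : F) :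
    pathCount (pairRel e α x y 0) (pairRel e α y y (k + k ^ 2)) β γ = 1 ↔
      ∃! u, (e α).1.IsLink k (vec e α β) (vec e α γ) u := by
  obtain ⟨hβ, hγ, -⟩ := h
  simp only at hβ hγ
  rw [pathCount_eq_one_iff, ← existsUnique_vec_iff e α fun u hu => by rw [hu.1, hγ, hy]]
  simp only [PlaneForm.IsLink, pairRel, Set.mem_ofPred_eq, hβ, hγ]
  grind

theorem scalarRel_eq_inter (hx0 : x ≠ 0) (hkx : Tr (k ^ 2 * x) = 0) (hk : k + k ^ 2 ≠ 0)
    (h1 : k * x ≠ 1) (h2 : (k + 1) * x ≠ 1) :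
    scalarRel e α x k = pairRel e α x (k ^ 2 * x) 0 ∩ {p | pathCount (pairRel e α x (k ^ 2 * x) 0)
      (pairRel e α (k ^ 2 * x) (k ^ 2 * x) (k + k ^ 2)) p.1 p.2 ≠ 1} := by
  have hiff {β γ : Ω} (h : (β, γ) ∈ pairRel e α x (k ^ 2 * x) 0) :
      vec e α γ = k • vec e α β ↔ pathCount (pairRel e α x (k ^ 2 * x) 0)
        (pairRel e α (k ^ 2 * x) (k ^ 2 * x) (k + k ^ 2)) β γ ≠ 1 := by
    rw [Ne, pathCount_pairRel_eq_one_iff hkx h]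
    obtain ⟨rfl, hγ, hβγ⟩ := h
    exact PlaneForm.eq_smul_iff_not_existsUnique_isLink hx0 hγ hβγ hk h1 h2
  ext ⟨β, γ⟩
  constructor
  · intro h
    have hp : (β, γ) ∈ pairRel e α x (k ^ 2 * x) 0 :=
      ⟨h.1, (scalarRel_subset e α x k h).2, by simp [h.2, polarForm_self]⟩
    exact ⟨hp, (hiff hp).1 h.2⟩
  · rintro ⟨hp, hcount⟩
    exact ⟨hp.1, (hiff hp).2 hcount⟩

variable {G : Subgroup (Equiv.Perm Ω)}

theorem IsEllipticModel.labelRel_mem_basis (he : IsEllipticModel G e) (hx : Tr x = 0) :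
    labelRel e x ∈ (inv G).basis :=
  he.isHollmannLabelling.bijOn.mapsTo (Set.mem_univ (⟨x, hx⟩ : traceZero F))

variable [Finite Ω]

namespace IsEllipticModel

theorem nbr_prod_nbr_mem_relations (he : IsEllipticModel G e) (α : Ω) (hx : Tr x = 0)
    (hy : Tr y = 0) : nbr α (labelRel e x) ×ˢ nbr α (labelRel e y) ∈
      ((inv G).pointExtension α).relations :=
  CoherentConfiguration.nbr_prod_nbr_mem_relations
    (diagOn_singleton_mem_relations_pointExtension _ α)
    (basis_subset_relations_pointExtension _ α (he.labelRel_mem_basis hx))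
    (basis_subset_relations_pointExtension _ α (he.labelRel_mem_basis hy))

theorem pairRel_mem_relations (he : IsEllipticModel G e) (α : Ω) (hx : Tr x = 0) (hy : Tr y = 0)
    (ht : Tr t = 0) : pairRel e α x y t ∈ ((inv G).pointExtension α).relations := by
  rw [pairRel_eq]
  refine inter_mem_relations (he.nbr_prod_nbr_mem_relations α hx hy)
    (basis_subset_relations_pointExtension _ α (he.labelRel_mem_basis ?_))
  rw [map_add, map_add, hx, hy, ht, add_zero, add_zero]

theorem scalarRel_one_mem_relations (he : IsEllipticModel G e) (α : Ω) (hx : Tr x = 0) :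
    scalarRel e α x 1 ∈ ((inv G).pointExtension α).relations := by
  rw [scalarRel_one]
  exact inter_mem_relations (he.nbr_prod_nbr_mem_relations α hx hx) diagonal_mem_relations

theorem scalarRel_mem_relations_of_add_one_mul_ne_one (he : IsEllipticModel G e) (α : Ω)
    (hx : Tr x = 0) (hkx : Tr (k ^ 2 * x) = 0) (hx0 : x ≠ 0) (hk0 : k ≠ 0) (hk1 : k ≠ 1)
    (h1 : k * x ≠ 1) (h2 : (k + 1) * x ≠ 1) :
    scalarRel e α x k ∈ ((inv G).pointExtension α).relations := by
  have hk : k + k ^ 2 ≠ 0 := fun h => (add_sq_eq_zero_iff.1 h).elim hk0 hk1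
  have hp := he.pairRel_mem_relations α hx hkx (map_zero _)
  rw [scalarRel_eq_inter hx0 hkx hk h1 h2]
  exact inter_mem_relations hp (setOf_pathCount_mem_relations hp
    (he.pairRel_mem_relations α hkx hkx (trace_add_sq k)) (· ≠ 1))

theorem scalarRel_mem_relations_of_mul_ne_one (he : IsEllipticModel G e) (α : Ω)
    (hx : Tr x = 0) (hkx : Tr (k ^ 2 * x) = 0) (hx0 : x ≠ 0) (hk0 : k ≠ 0) (h1 : k * x ≠ 1) :
    scalarRel e α x k ∈ ((inv G).pointExtension α).relations := by
  rcases eq_or_ne k 1 with rfl | hk1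
  · exact he.scalarRel_one_mem_relations α hx
  by_cases h2 : (k + 1) * x = 1
  · have hxk : k⁻¹ ^ 2 * (k ^ 2 * x) = x := by field_simp
    have hstar : scalarRel e α x k = relStar (scalarRel e α (k ^ 2 * x) k⁻¹) := by
      rw [relStar_scalarRel e α _ (inv_ne_zero hk0), hxk, inv_inv]
    have h1' : k⁻¹ * (k ^ 2 * x) = k * x := by field_simp
    rw [hstar]
    refine relStar_mem_relations (he.scalarRel_mem_relations_of_add_one_mul_ne_one α hkx
      (hxk.symm ▸ hx) (mul_ne_zero (pow_ne_zero 2 hk0) hx0) (inv_ne_zero hk0) (inv_ne_one.2 hk1)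
      (h1' ▸ h1) fun h2' => hk1 ?_)
    calc
      k = k * ((k + 1) * x) := by rw [h2, mul_one]
      _ = (k⁻¹ + 1) * (k ^ 2 * x) := by rw [add_mul, add_mul, h1']; ring
      _ = 1 := h2'
  · exact he.scalarRel_mem_relations_of_add_one_mul_ne_one α hx hkx hx0 hk0 hk1 h1 h2

-- If `k * x = 1` and `k ≠ 1`, then `k` factors as `(k / (k + 1)) * (k + 1)`, which amounts to
-- composing two of the previous relations through the vectors of value `x + k ^ 2 * x`.
theorem scalarRel_mem_relations (he : IsEllipticModel G e) (α : Ω) (hx : Tr x = 0)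
    (hkx : Tr (k ^ 2 * x) = 0) (hx0 : x ≠ 0) (hk0 : k ≠ 0) :
    scalarRel e α x k ∈ ((inv G).pointExtension α).relations := by
  rcases eq_or_ne k 1 with rfl | hk1
  · exact he.scalarRel_one_mem_relations α hx
  by_cases h1 : k * x = 1
  · have hk1' : k + 1 ≠ 0 := fun h => hk1 (CharTwo.add_eq_zero.1 h)
    have hy : (k + 1) ^ 2 * x = x + k ^ 2 * x := by grind
    have hytr : Tr ((k + 1) ^ 2 * x) = 0 := by rw [hy, map_add, hx, hkx, add_zero]
    have hl : (k / (k + 1)) ^ 2 * ((k + 1) ^ 2 * x) = k ^ 2 * x := by field_simp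
    have hkl : k / (k + 1) * (k + 1) = k := div_mul_cancel₀ k hk1'
    rw [← hkl, ← scalarRel_comp_scalarRel hytr]
    refine comp_mem_relations
      (he.scalarRel_mem_relations_of_mul_ne_one α hx hytr hx0 hk1' fun h => hx0 ?_)
      (he.scalarRel_mem_relations_of_mul_ne_one α hytr (hl.symm ▸ hkx)
        (mul_ne_zero (pow_ne_zero 2 hk1') hx0) (div_ne_zero hk0 hk1') fun h => hk0 ?_)
    · rwa [add_mul, h1, one_mul, add_eq_left] at h
    · calc
        k = k / (k + 1) * ((k + 1) ^ 2 * x) + 1 := by field_simp; grind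
        _ = 0 := by rw [h, CharTwo.add_self_eq_zero]
  · exact he.scalarRel_mem_relations_of_mul_ne_one α hx hkx hx0 hk0 h1

theorem nbr_labelRel_mem_fibers (he : IsEllipticModel G e) (α : Ω) (hx : Tr x = 0) :
    nbr α (labelRel e x) ∈ ((inv G).pointExtension α).fibers :=
  nbr_mem_fibers (he.labelRel_mem_basis hx) (exists_mem_labelRel e α hx)

theorem exists_isMatching (he : IsEllipticModel G e) (α : Ω) (hx : Tr x = 0) (hy : Tr y = 0)
    (hx0 : x ≠ 0) (hy0 : y ≠ 0) :
    ∃ r ∈ ((inv G).pointExtension α).basisBetween (nbr α (labelRel e x)) (nbr α (labelRel e y)),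
      ((inv G).pointExtension α).IsMatching r := by
  obtain ⟨k, hk⟩ : ∃ k : F, k ^ 2 = y / x := surjective_frobenius F 2 (y / x)
  obtain rfl : k ^ 2 * x = y := by rw [hk, div_mul_cancel₀ y hx0]
  have hk0 : k ≠ 0 := by
    rintro rfl
    simp at hy0
  have hxk : k⁻¹ ^ 2 * (k ^ 2 * x) = x := by field_simp
  refine ⟨scalarRel e α x k, isMatching_of_existsUnique (he.nbr_labelRel_mem_fibers α hx)
    (he.nbr_labelRel_mem_fibers α hy) (he.scalarRel_mem_relations α hx hy hx0 hk0)
    (scalarRel_subset e α x k) (fun β hβ => existsUnique_scalarRel hy hβ) fun γ hγ => ?_⟩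
  have h := existsUnique_scalarRel (k := k⁻¹) (hxk.symm ▸ hx) hγ
  rwa [← relStar_scalarRel e α x hk0] at h

end IsEllipticModel

end Matching

section Main

variable {F : Type*} [Field F] [Finite F] [Algebra (ZMod 2) F] {Ω : Type*}
  {e : Ω ≃ EllipticForm F} {G : Subgroup (Equiv.Perm Ω)}

theorem IsEllipticModel.exists_eq_labelRel (he : IsEllipticModel G e)
    {s : traceZero F → Set (Ω × Ω)} (hs : IsHollmannLabelling (inv G) s) {x : traceZero F}
    (hx : x ≠ 0) : ∃ x' : traceZero F, (x' : F) ≠ 0 ∧ s x = labelRel e x' := by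
  obtain ⟨x', -, hx'⟩ := he.isHollmannLabelling.bijOn.surjOn (hs.bijOn.mapsTo (Set.mem_univ x))
  refine ⟨x', fun h0 => hx ?_, hx'.symm⟩
  refine hs.bijOn.injOn (Set.mem_univ x) (Set.mem_univ 0) ?_
  rw [hs.zero, ← hx', ← labelRel_zero (e := e), ← h0]

end Main

end Hollmann

theorem theorem3p2_general {F : Type*} [Field F] [Finite F] [Algebra (ZMod 2) F]
    {Ω : Type*} [Finite Ω] (G : Subgroup (Equiv.Perm Ω)) (hG : Hollmann.IsHollmannGroup F G) :
    (∃ s : Hollmann.traceZero F → Set (Ω × Ω),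
      Hollmann.IsHollmannLabelling (Hollmann.inv G) s) ∧
    ∀ s : Hollmann.traceZero F → Set (Ω × Ω),
      Hollmann.IsHollmannLabelling (Hollmann.inv G) s →
      ∀ (α : Ω) (x y : Hollmann.traceZero F), x ≠ 0 → y ≠ 0 →
        Hollmann.nbr α (s x) ∈ ((Hollmann.inv G).pointExtension α).fibers ∧
        Hollmann.nbr α (s y) ∈ ((Hollmann.inv G).pointExtension α).fibers ∧
        ∃ r ∈ ((Hollmann.inv G).pointExtension α).basisBetween
            (Hollmann.nbr α (s x)) (Hollmann.nbr α (s y)),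
          ((Hollmann.inv G).pointExtension α).IsMatching r := by
  obtain ⟨e, he⟩ := hG.exists_isEllipticModel
  refine ⟨⟨_, he.isHollmannLabelling⟩, fun s hs α x y hx hy => ?_⟩
  obtain ⟨x', hx0, hsx⟩ := he.exists_eq_labelRel hs hx
  obtain ⟨y', hy0, hsy⟩ := he.exists_eq_labelRel hs hy
  rw [hsx, hsy]
  exact ⟨he.nbr_labelRel_mem_fibers α x'.2, he.nbr_labelRel_mem_fibers α y'.2,
    he.exists_isMatching α x'.2 y'.2 hx0 hy0⟩

theorem theorem3p2 {d : ℕ} (hd : 3 ≤ d) {F : Type*} [Field F] [Finite F]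
    [Algebra (ZMod 2) F] (hF : Nat.card F = 2 ^ d) {Ω : Type*} [Finite Ω]
    (G : Subgroup (Equiv.Perm Ω)) (hG : Hollmann.IsHollmannGroup F G) :
    (∃ s : Hollmann.traceZero F → Set (Ω × Ω),
      Hollmann.IsHollmannLabelling (Hollmann.inv G) s) ∧
    ∀ s : Hollmann.traceZero F → Set (Ω × Ω),
      Hollmann.IsHollmannLabelling (Hollmann.inv G) s →
      ∀ (α : Ω) (x y : Hollmann.traceZero F), x ≠ 0 → y ≠ 0 →
        Hollmann.nbr α (s x) ∈ ((Hollmann.inv G).pointExtension α).fibers ∧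
        Hollmann.nbr α (s y) ∈ ((Hollmann.inv G).pointExtension α).fibers ∧
        ∃ r ∈ ((Hollmann.inv G).pointExtension α).basisBetween
            (Hollmann.nbr α (s x)) (Hollmann.nbr α (s y)),
          ((Hollmann.inv G).pointExtension α).IsMatching r :=
  theorem3p2_general G hG
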